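/- Let $n\ge 1$, let $\Omega\subset\mathbb{R}^n$ be a nonempty bounded open set with $C^1$ boundary (not necessarily connected), that is, near each boundary point there are orthogonal coordinates $y=(y',y_n)$ and an open box in which $\Omega$ is the set $\{y_n<\varphi(y')\}$ and $\partial\Omega$ the graph $\{y_n=\varphi(y')\}$ of a $C^1$ function $\varphi$. Let $p>1$, let $W^{1,p}(\Omega)$ be the Sobolev space of real-valued functions $u\in L^p(\Omega)$ with weak gradient $\nabla u\in L^p(\Omega)$, and let $\mathrm{d}s$ be the hypersurface measure on $\partial\Omega$. For $\alpha>0$ set \[ \Lambda(\alpha)=\inf_{u\in W^{1,p}(\Omega),\ u\not\equiv 0}\ \frac{\displaystyle\int_\Omega|\nabla u|^p\,\mathrm{d}x-\alpha\int_{\partial\Omega}|u|^p\,\mathrm{d}s}{\displaystyle\int_\Omega|u|^p\,\mathrm{d}x}, \] where the values of $u$ on $\partial\Omega$ are understood in the sense of traces: the trace of $u$ is the limit in $L^p(\partial\Omega)$ of the restrictions $v_k|_{\partial\Omega}$ of $C^1$ functions $v_k$ on $\mathbb{R}^n$ with $v_k\to u$ in $W^{1,p}(\Omega)$. Then $\Lambda(\alpha)$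 is finite for every $\alpha>0$, and \[ \Lambda(\alpha)=(1-p)\,\alpha^{\frac{p}{p-1}}+o\big(\alpha^{\frac{p}{p-1}}\big)\qquad\text{as }\alpha\to+\infty . \] -/

import Mathlib

open Set Filter Topology MeasureTheory Asymptotics
open scoped ENNReal ContDiff

namespace RobinPLaplacian

noncomputable section

/-- The first `d` coordinates `y' = (y₁, …, y_d)` of a point `y ∈ ℝ^(d+1)`. -/
def firstCoords {d : ℕ} (y : EuclideanSpace ℝ (Fin (d + 1))) : EuclideanSpace ℝ (Fin d) :=
  WithLp.toLp 2 (fun i : Fin d => y i.castSucc)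

/-- The boundary of `Ω ⊆ ℝ^(d+1)` is of class `C¹`: near each boundary point there are orthogonal
coordinates `y = T z` and a box `V = {|yᵢ| < aᵢ for all i}` in which `Ω` is the region strictly
below the graph of a `C¹` function `φ` on `V' = {|yᵢ| < aᵢ for i ≤ d}` with
`|φ| ≤ a_{d+1} / 2`, and `∂Ω` is that graph. -/
def HasC1Boundary {d : ℕ} (Ω : Set (EuclideanSpace ℝ (Fin (d + 1)))) : Prop :=
  ∀ x ∈ frontier Ω,
    ∃ (T : EuclideanSpace ℝ (Fin (d + 1)) ≃ᵃⁱ[ℝ] EuclideanSpace ℝ (Fin (d + 1)))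
      (a : Fin (d + 1) → ℝ) (φ : EuclideanSpace ℝ (Fin d) → ℝ),
      (∀ i, 0 < a i) ∧
      (∀ i, |T x i| < a i) ∧
      ContDiffOn ℝ 1 φ {y | ∀ i : Fin d, |y i| < a i.castSucc} ∧
      (∀ y : EuclideanSpace ℝ (Fin d), (∀ i : Fin d, |y i| < a i.castSucc) →
        |φ y| ≤ a (Fin.last d) / 2) ∧
      ∀ z : EuclideanSpace ℝ (Fin (d + 1)), (∀ i, |T z i| < a i) →
        (z ∈ Ω ↔ T z (Fin.last d) < φ (firstCoords (T z))) ∧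
        (z ∈ frontier Ω ↔ T z (Fin.last d) = φ (firstCoords (T z)))

/-- The hypersurface measure `ds` on `∂Ω`: the `d`-dimensional Hausdorff measure of `ℝ^(d+1)`,
normalized so as to agree with Lebesgue measure on `d`-dimensional planes, restricted to `∂Ω`. -/
def surfaceMeasure {d : ℕ} (Ω : Set (EuclideanSpace ℝ (Fin (d + 1)))) :
    Measure (EuclideanSpace ℝ (Fin (d + 1))) :=
  (μHE[d]).restrict (frontier Ω)

/-- `u ∈ W^{1,p}(Ω)` with weak gradient `G`: both are in `L^p(Ω)`, and
`∫_Ω u ∇ψ = - ∫_Ω ψ G` for all test functions `ψ ∈ C_c^∞(Ω)`. -/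
def IsSobolevWithGradient {d : ℕ} (p : ℝ) (Ω : Set (EuclideanSpace ℝ (Fin (d + 1))))
    (u : EuclideanSpace ℝ (Fin (d + 1)) → ℝ)
    (G : EuclideanSpace ℝ (Fin (d + 1)) → EuclideanSpace ℝ (Fin (d + 1))) : Prop :=
  MemLp u (ENNReal.ofReal p) (volume.restrict Ω) ∧
  MemLp G (ENNReal.ofReal p) (volume.restrict Ω) ∧
  ∀ ψ : EuclideanSpace ℝ (Fin (d + 1)) → ℝ, ContDiff ℝ ∞ ψ → HasCompactSupport ψ →
    tsupport ψ ⊆ Ω →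
    ∫ x in Ω, u x • gradient ψ x = - ∫ x in Ω, ψ x • G x

/-- `g ∈ L^p(∂Ω)` is the trace on `∂Ω` of a function `u ∈ W^{1,p}(Ω)` with weak gradient `G`:
for some `C¹` functions `v k` on `ℝ^(d+1)`, the restrictions of `v k` to `Ω` converge to `u` in
`W^{1,p}(Ω)` and the restrictions of `v k` to `∂Ω` converge to `g` in `L^p(∂Ω)`. -/
def IsTrace {d : ℕ} (p : ℝ) (Ω : Set (EuclideanSpace ℝ (Fin (d + 1))))
    (u : EuclideanSpace ℝ (Fin (d + 1)) → ℝ)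
    (G : EuclideanSpace ℝ (Fin (d + 1)) → EuclideanSpace ℝ (Fin (d + 1)))
    (g : EuclideanSpace ℝ (Fin (d + 1)) → ℝ) : Prop :=
  MemLp g (ENNReal.ofReal p) (surfaceMeasure Ω) ∧
  ∃ v : ℕ → EuclideanSpace ℝ (Fin (d + 1)) → ℝ,
    (∀ k, ContDiff ℝ 1 (v k)) ∧
    Tendsto (fun k => eLpNorm (fun x => v k x - u x) (ENNReal.ofReal p) (volume.restrict Ω))
      atTop (𝓝 0) ∧
    Tendsto (fun k => eLpNorm (fun x => gradient (v k) x - G x) (ENNReal.ofReal p)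
      (volume.restrict Ω)) atTop (𝓝 0) ∧
    Tendsto (fun k => eLpNorm (fun x => v k x - g x) (ENNReal.ofReal p) (surfaceMeasure Ω))
      atTop (𝓝 0)

/-- The values of the Rayleigh quotient
`(∫_Ω |∇u|^p dx - α ∫_{∂Ω} |u|^p ds) / ∫_Ω |u|^p dx` over all `u ∈ W^{1,p}(Ω)`, `u ≢ 0`.
Here `G` is the weak gradient of `u` and `g` its trace on `∂Ω`. -/
def rayleighValues {d : ℕ} (p : ℝ) (Ω : Set (EuclideanSpace ℝ (Fin (d + 1)))) (α : ℝ) : Set ℝ :=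
  {q | ∃ (u : EuclideanSpace ℝ (Fin (d + 1)) → ℝ)
      (G : EuclideanSpace ℝ (Fin (d + 1)) → EuclideanSpace ℝ (Fin (d + 1)))
      (g : EuclideanSpace ℝ (Fin (d + 1)) → ℝ),
      IsSobolevWithGradient p Ω u G ∧ IsTrace p Ω u G g ∧
      ¬ (u =ᵐ[volume.restrict Ω] 0) ∧
      q = ((∫ x in Ω, ‖G x‖ ^ p) - α * ∫ x, |g x| ^ p ∂(surfaceMeasure Ω))
        / ∫ x in Ω, |u x| ^ p}

/-- `Λ(α)`, the infimum of the Rayleigh quotient. -/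
def Lam {d : ℕ} (p : ℝ) (Ω : Set (EuclideanSpace ℝ (Fin (d + 1)))) (α : ℝ) : ℝ :=
  sInf (rayleighValues p Ω α)

end

end RobinPLaplacian

open scoped NNReal

namespace RobinPLaplacian

/-! Both bounds compare a boundary integral with a flux. Near a boundary point a `C¹` boundary is
almost flat: for every slope `δ` there is one direction `ν` that works as an approximate outer
normal at all nearby boundary points (`HasNormalCone`). Hence a line parallel to `ν` leaves `Ω` at
most once inside a small ball, and Fubini with the fundamental theorem of calculus turns `∫_Ω ∂_ν w`
into an integral of `w` over the projected boundary piece. Projection and graph map have Lipschitz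
constants `1` and `1 + k`, so this is the surface integral of `w ≥ 0` up to a factor `(1 + k)^d`
(`HasNormalCone.setIntegral_frontier`).

Lower bound: a partition of unity gives `∫_{∂Ω} w ≤ L ∫_Ω |∇w| + C ∫_Ω w` for any `L > 1`. With `w =
|v|^p`, Young's inequality bounds `α ∫_{∂Ω} |v|^p` by `∫ |∇v|^p + ((p-1)(Lα)^{p/(p-1)} + Cα) ∫
|v|^p`. The term `Cα` is of lower order because `p/(p-1) > 1`.

Upper bound: put `β = α^{1/(p-1)}`, the scale at which Young's inequality is sharp. A cut-off of
`exp(β⟨ν, x - x₀⟩)`, slightly penalized, has `|∇u| ≈ βu` and `∂_ν(u^p) ≈ pβu^p`. Its quotient is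
therefore at most about `β^p - β^{p-1}·pβ = (1-p)β^p` (`HasNormalCones.exists_rayleigh_le`). -/

/-- In the closed ball of radius `r` around `x₀`, the set `Ω` contains the part of each cone with
vertex on `∂Ω` and axis `-ν` of slope `δ`, and the opposite cones lie outside of `closure Ω`. -/
structure HasNormalCone {E : Type*} [NormedAddCommGroup E] [InnerProductSpace ℝ E]
    (Ω : Set E) (ν : E) (δ r : ℝ) (x₀ : E) : Prop where
  norm_eq : ‖ν‖ = 1
  mem : ∀ x ∈ frontier Ω, x ∈ Metric.closedBall x₀ r → ∀ z ∈ Metric.closedBall x₀ r,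
    inner ℝ ν (z - x) < -(δ * ‖z - x‖) → z ∈ Ω
  notMem : ∀ x ∈ frontier Ω, x ∈ Metric.closedBall x₀ r → ∀ z ∈ Metric.closedBall x₀ r,
    δ * ‖z - x‖ < inner ℝ ν (z - x) → z ∉ closure Ω

/-- The defining function `ψ = y_n - φ(y')` vanishes on the boundary and is negative exactly on `Ω`,
near `x₀`. Its normalized gradient at `x₀` serves as `ν`; the linearization error is at most `δ`
times the gradient norm, so the sign of `ψ` is known in the cones. -/
theorem HasC1Boundary.exists_hasNormalCone {d : ℕ} {Ω : Set (EuclideanSpace ℝ (Fin (d + 1)))}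
    (hΩ : HasC1Boundary Ω) {x₀ : EuclideanSpace ℝ (Fin (d + 1))} (hx₀ : x₀ ∈ frontier Ω)
    {δ : ℝ} (hδ : 0 < δ) : ∃ ν, ∃ r > 0, HasNormalCone Ω ν δ r x₀ := by
  obtain ⟨T, a, φ, -, hx₀a, hφ, -, hT⟩ := hΩ x₀ hx₀
  have hfc : ContDiff ℝ 1 (firstCoords (d := d)) := by
    rw [contDiff_euclidean]
    intro i
    simp only [firstCoords]
    fun_prop
  have hTc : ContDiff ℝ 1 T := T.toAffineIsometry.toContinuousAffineMap.contDiff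
  have hV : IsOpen {y : EuclideanSpace ℝ (Fin d) | ∀ i : Fin d, |y i| < a i.castSucc} := by
    simp only [ofPred_forall]
    exact isOpen_iInter_of_finite fun i => isOpen_lt (by fun_prop) continuous_const
  set ψ : EuclideanSpace ℝ (Fin (d + 1)) → ℝ :=
    fun z => T z (Fin.last d) - φ (firstCoords (T z)) with hψ
  have hψc : ContDiffAt ℝ 1 ψ x₀ := by
    refine ContDiffAt.sub ?_ ?_
    · exact ContDiff.contDiffAt (by fun_prop)
    · refine ContDiffAt.comp x₀ (g := φ) (f := fun z => firstCoords (T z)) ?_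
        (hfc.comp hTc).contDiffAt
      exact hφ.contDiffAt (hV.mem_nhds fun i => hx₀a i.castSucc)
  -- Strict differentiability controls `ψ z - ψ x` with both points moving, which gives cones at
  -- every boundary point near `x₀` with the same `ν`.
  have hs := hψc.hasStrictFDerivAt one_ne_zero
  set ψ' := fderiv ℝ ψ x₀
  set m := (InnerProductSpace.toDual ℝ (EuclideanSpace ℝ (Fin (d + 1)))).symm ψ' with hm
  have hmi : ∀ z, inner ℝ m z = ψ' z := fun z => by simp [hm]
  have hm0 : m ≠ 0 := by
    intro h0
    -- Along the graph direction `ψ` increases at unit speed, so its derivative cannot vanish.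
    set v := T.linearIsometryEquiv.symm (EuclideanSpace.single (Fin.last d) (1 : ℝ)) with hv
    have hline : ∀ t : ℝ, T (x₀ + t • v) = T x₀ + t • EuclideanSpace.single (Fin.last d) (1 : ℝ) := by
      intro t
      have := T.map_vadd x₀ (t • v)
      simp only [vadd_eq_add] at this
      rw [add_comm x₀, this, map_smul, hv, LinearIsometryEquiv.apply_symm_apply, add_comm (T x₀)]
    have hline' : ∀ t : ℝ, ψ (x₀ + t • v) = ψ x₀ + t := by
      intro t
      have : firstCoords (T (x₀ + t • v)) = firstCoords (T x₀) := by
        rw [hline]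
        ext i
        simp [firstCoords, Fin.castSucc_ne_last]
      simp only [hψ, this]
      rw [hline]
      simp
      ring
    have h1 : HasDerivAt (fun t : ℝ => ψ (x₀ + t • v)) (ψ' v) 0 := by
      have h2 : HasDerivAt (fun t : ℝ => x₀ + t • v) v 0 := by
        simpa using ((hasDerivAt_id (0 : ℝ)).smul_const v).const_add x₀
      have h3 : HasFDerivAt ψ ψ' (x₀ + (0 : ℝ) • v) := by simpa using hs.hasFDerivAt
      exact h3.comp_hasDerivAt 0 h2
    have h4 : HasDerivAt (fun t : ℝ => ψ (x₀ + t • v)) 1 0 := by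
      simp only [hline']
      exact (hasDerivAt_id (0 : ℝ)).const_add _
    have := h1.unique h4
    rw [← hmi, h0, inner_zero_left] at this
    exact zero_ne_one this
  have hmpos : 0 < ‖m‖ := norm_pos_iff.2 hm0
  have hev := hs.isLittleO.def (mul_pos hδ hmpos)
  have hbox : ∀ᶠ z in 𝓝 x₀, ∀ i, |T z i| < a i := by
    rw [eventually_all]
    intro i
    have : Continuous fun z => |T z i| := by
      have := hTc.continuous
      fun_prop
    exact this.continuousAt.eventually_lt continuousAt_const (hx₀a i)
  rw [nhds_prod_eq] at hev
  obtain ⟨r, hr, hball⟩ := (Metric.nhds_basis_closedBall.prod_self).eventually_iff.1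
    (hev.and (hbox.prod_mk hbox))
  have hinner : ∀ z, inner ℝ (‖m‖⁻¹ • m) z = ‖m‖⁻¹ * ψ' z := fun z => by
    rw [real_inner_smul_left, hmi]
  have hzero : ∀ x ∈ frontier Ω, (∀ i, |T x i| < a i) → ψ x = 0 := fun x hx hxa => by
    rw [hψ]
    exact sub_eq_zero.2 ((hT x hxa).2.1 hx)
  refine ⟨‖m‖⁻¹ • m, r, hr, ?_, ?_, ?_⟩
  · rw [norm_smul, norm_inv, norm_norm, inv_mul_cancel₀ hmpos.ne']
  · intro x hx hxr z hz h
    obtain ⟨h1, hza, hxa⟩ := @hball (z, x) ⟨hz, hxr⟩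
    rw [hinner, inv_mul_lt_iff₀ hmpos] at h
    have h2 := (abs_le.1 h1).2
    simp only [hzero x hx hxa] at h2
    refine (hT z hza).1.2 (sub_neg.1 (show ψ z < 0 from ?_))
    linarith
  · intro x hx hxr z hz h
    obtain ⟨h1, hza, hxa⟩ := @hball (z, x) ⟨hz, hxr⟩
    rw [hinner, lt_inv_mul_iff₀ hmpos] at h
    have h2 := (abs_le.1 h1).1
    simp only [hzero x hx hxa] at h2
    have h3 : 0 < ψ z := by linarith
    rw [closure_eq_self_union_frontier]
    rintro (hzΩ | hzΩ)
    · exact absurd ((hT z hza).1.1 hzΩ) (not_lt.2 (sub_pos.1 h3).le)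
    · exact h3.ne' (hzero z hzΩ hza)

/-! ### Fubini along lines parallel to a unit vector -/

section Slicing

variable {E : Type*} [NormedAddCommGroup E] [InnerProductSpace ℝ E]

/-- The orthogonal projection onto the hyperplane orthogonal to `ν`. -/
noncomputable abbrev hyperProj (ν : E) : E →L[ℝ] (ℝ ∙ ν)ᗮ := (ℝ ∙ ν)ᗮ.orthogonalProjectionOnto

theorem hyperProj_add_inner_smul {ν : E} (hν : ‖ν‖ = 1) (x : E) :
    (hyperProj ν x : E) + inner ℝ ν x • ν = x := by
  have h := Submodule.starProjection_add_starProjection_orthogonal (K := ℝ ∙ ν) x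
  rw [Submodule.starProjection_unit_singleton ℝ hν] at h
  rw [add_comm]
  exact h

theorem inner_coe_hyperplane (ν : E) (y : (ℝ ∙ ν)ᗮ) : inner ℝ ν (y : E) = 0 :=
  Submodule.mem_orthogonal_singleton_iff_inner_right.1 y.2

theorem inner_add_smul {ν : E} (hν : ‖ν‖ = 1) (y : (ℝ ∙ ν)ᗮ) (s : ℝ) :
    inner ℝ ν ((y : E) + s • ν) = s := by
  rw [inner_add_right, inner_coe_hyperplane, real_inner_smul_right, real_inner_self_eq_norm_sq, hν]
  simp

theorem hyperProj_add_smul {ν : E} (hν : ‖ν‖ = 1) (y : (ℝ ∙ ν)ᗮ) (s : ℝ) :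
    hyperProj ν ((y : E) + s • ν) = y := by
  have h := hyperProj_add_inner_smul hν ((y : E) + s • ν)
  rw [inner_add_smul hν] at h
  exact Subtype.ext (add_right_cancel h)

theorem norm_hyperplane_add_smul_sq {ν : E} (hν : ‖ν‖ = 1) (y : (ℝ ∙ ν)ᗮ) (s : ℝ) :
    ‖(y : E) + s • ν‖ ^ 2 = ‖y‖ ^ 2 + s ^ 2 := by
  rw [norm_add_sq_real, real_inner_smul_right, real_inner_comm, inner_coe_hyperplane, norm_smul, hν]
  simp

variable [FiniteDimensional ℝ E] [MeasurableSpace E] [BorelSpace E]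

theorem measurePreserving_hyperplane_add_smul {ν : E} (hν : ‖ν‖ = 1) :
    MeasurePreserving (fun q : (ℝ ∙ ν)ᗮ × ℝ => (q.1 : E) + q.2 • ν) := by
  have h1 := (LinearIsometryEquiv.toSpanUnitSingleton (𝕜 := ℝ) ν hν).measurePreserving
  have h2 : MeasurePreserving
      (Prod.map (LinearIsometryEquiv.toSpanUnitSingleton (𝕜 := ℝ) ν hν) (id : (ℝ ∙ ν)ᗮ → (ℝ ∙ ν)ᗮ)) :=
    h1.prod (MeasurePreserving.id volume)
  have h3 := (WithLp.volume_preserving_toLp (ℝ ∙ ν) (ℝ ∙ ν)ᗮ).comp h2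
  have h4 := (ℝ ∙ ν).orthogonalDecomposition.symm.measurePreserving.comp h3
  have h5 := h4.comp (Measure.measurePreserving_swap (μ := (volume : Measure (ℝ ∙ ν)ᗮ))
    (ν := (volume : Measure ℝ)))
  convert! h5 using 1
  ext q
  simp [add_comm]

theorem integral_eq_integral_hyperplane_integral {ν : E} (hν : ‖ν‖ = 1) {f : E → ℝ}
    (hf : Integrable f) : ∫ x, f x = ∫ y : (ℝ ∙ ν)ᗮ, ∫ s : ℝ, f ((y : E) + s • ν) := by
  have hmp := measurePreserving_hyperplane_add_smul hν
  rw [← hmp.map_eq, integral_map hmp.aemeasurable (by rw [hmp.map_eq]; exact hf.1),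
    Measure.volume_eq_prod, integral_prod]
  rw [← Measure.volume_eq_prod]
  exact (hmp.integrable_comp hf.1).2 hf

end Slicing

/-! ### The boundary as a Lipschitz graph -/

section Cone

variable {E : Type*} [NormedAddCommGroup E] [InnerProductSpace ℝ E]
  {Ω : Set E} {ν x₀ : E} {δ r : ℝ}

theorem HasNormalCone.abs_inner_le (h : HasNormalCone Ω ν δ r x₀) (hΩ : IsOpen Ω) {x z : E}
    (hx : x ∈ frontier Ω) (hxr : x ∈ Metric.closedBall x₀ r) (hz : z ∈ frontier Ω)
    (hzr : z ∈ Metric.closedBall x₀ r) : |inner ℝ ν (z - x)| ≤ δ * ‖z - x‖ := by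
  rw [hΩ.frontier_eq] at hz
  refine abs_le.2 ⟨?_, ?_⟩
  · by_contra! hlt
    exact hz.2 (h.mem x hx hxr z hzr hlt)
  · by_contra! hlt
    exact h.notMem x hx hxr z hzr hlt hz.1

/-- The cones give `h² ≤ δ²(A + h²)` for the height difference `h` and squared horizontal distance
`A` of two boundary points. The condition on `k` says `δ² ≤ k²(1 - δ²)`, whence `h² ≤ k²A`. The
height is thus a `k`-Lipschitz function of the projection, and it extends to the whole hyperplane.
-/
theorem HasNormalCone.exists_height (h : HasNormalCone Ω ν δ r x₀) (hΩ : IsOpen Ω) {k : ℝ≥0}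
    (hδ : 0 ≤ δ) (hk : δ ^ 2 * (1 + (k : ℝ) ^ 2) ≤ (k : ℝ) ^ 2) (hδ1 : δ < 1) :
    ∃ f : (ℝ ∙ ν)ᗮ → ℝ, LipschitzWith k f ∧
      ∀ x ∈ frontier Ω ∩ Metric.closedBall x₀ r, f (hyperProj ν x) = inner ℝ ν x := by
  have hν := h.norm_eq
  set S := frontier Ω ∩ Metric.closedBall x₀ r
  have key : ∀ x ∈ S, ∀ z ∈ S,
      |inner ℝ ν z - inner ℝ ν x| ≤ k * ‖hyperProj ν z - hyperProj ν x‖ := by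
    intro x hx z hz
    have h1 := h.abs_inner_le hΩ hx.1 hx.2 hz.1 hz.2
    have h2 : ‖z - x‖ ^ 2 = ‖hyperProj ν z - hyperProj ν x‖ ^ 2 + (inner ℝ ν (z - x)) ^ 2 := by
      rw [← map_sub, ← norm_hyperplane_add_smul_sq hν, hyperProj_add_inner_smul hν]
    rw [← inner_sub_right]
    refine abs_le_of_sq_le_sq ?_ (by positivity)
    have h3 : (inner ℝ ν (z - x)) ^ 2 ≤ δ ^ 2 * ‖z - x‖ ^ 2 := by
      rw [← mul_pow, ← sq_abs]
      gcongr
    rw [h2] at h3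
    have hδ2 : δ ^ 2 < 1 := by nlinarith
    set A := ‖hyperProj ν z - hyperProj ν x‖ ^ 2
    have hA : 0 ≤ A := sq_nonneg _
    rw [mul_pow]
    have h4 : (1 - δ ^ 2) * (inner ℝ ν (z - x)) ^ 2 ≤ (1 - δ ^ 2) * ((k : ℝ) ^ 2 * A) := by
      nlinarith
    exact le_of_mul_le_mul_left h4 (by linarith)
  have hinj : InjOn (hyperProj ν) S := by
    intro x hx z hz hxz
    have := key x hx z hz
    rw [hxz, sub_self, norm_zero, mul_zero] at this
    rw [← hyperProj_add_inner_smul hν x, ← hyperProj_add_inner_smul hν z, hxz,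
      sub_eq_zero.1 (abs_nonpos_iff.1 this)]
  have hlip : LipschitzOnWith k (fun y => inner ℝ ν (Function.invFunOn (hyperProj ν) S y))
      (hyperProj ν '' S) := by
    refine LipschitzOnWith.of_dist_le_mul ?_
    rintro _ ⟨x, hx, rfl⟩ _ ⟨z, hz, rfl⟩
    rw [hinj.leftInvOn_invFunOn hx, hinj.leftInvOn_invFunOn hz, Real.dist_eq, dist_eq_norm]
    exact key z hz x hx
  obtain ⟨f, hf, hfe⟩ := hlip.extend_real
  refine ⟨f, hf, fun x hx => ?_⟩
  rw [← hfe (mem_image_of_mem _ hx)]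
  simp only
  rw [hinj.leftInvOn_invFunOn hx]

end Cone

/-! ### Flux through the boundary by integration along lines -/

section Flux

variable {E : Type*} [NormedAddCommGroup E] [InnerProductSpace ℝ E]
  {Ω : Set E} {ν x₀ : E} {δ r : ℝ} {w : E → ℝ} {f : (ℝ ∙ ν)ᗮ → ℝ}

/-- Since `δ < 1`, the directions `∓ν` lie in the inner and outer cones. If the line meets the
boundary in the ball, its part in `Ω` there is the part below height `f y`, and the integral of the
derivative is the boundary value. Otherwise its chord lies entirely inside or outside `Ω`, and the
integral is zero. -/
theorem HasNormalCone.integral_line (h : HasNormalCone Ω ν δ r x₀) (hΩ : IsOpen Ω)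
    (hδ1 : δ < 1)
    (hf : ∀ x ∈ frontier Ω ∩ Metric.closedBall x₀ r, f (hyperProj ν x) = inner ℝ ν x)
    (hw : ContDiff ℝ 1 w) (hwr : tsupport w ⊆ Metric.closedBall x₀ r) (y : (ℝ ∙ ν)ᗮ) :
    ∫ s : ℝ, Ω.indicator (fun x => fderiv ℝ w x ν) ((y : E) + s • ν) =
      (hyperProj ν '' (frontier Ω ∩ Metric.closedBall x₀ r)).indicator
        (fun y => w ((y : E) + f y • ν)) y := by
  have hν := h.norm_eq
  set g : ℝ → ℝ := fun s => w ((y : E) + s • ν) with hg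
  have hline : ∀ s : ℝ, HasDerivAt (fun s : ℝ => (y : E) + s • ν) ν s := fun s => by
    simpa using ((hasDerivAt_id s).smul_const ν).const_add (y : E)
  have hgd : ∀ s, HasDerivAt g (fderiv ℝ w ((y : E) + s • ν) ν) s := fun s =>
    (hw.differentiable one_ne_zero _).hasFDerivAt.comp_hasDerivAt s (hline s)
  have hgc : ContDiff ℝ 1 g := hw.comp (by fun_prop)
  have hgs : HasCompactSupport g := by
    refine HasCompactSupport.of_support_subset_isCompact
      (isCompact_closedBall (inner ℝ ν x₀) r) fun s hs => ?_
    have h1 : (y : E) + s • ν ∈ Metric.closedBall x₀ r := hwr (subset_tsupport w hs)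
    rw [mem_closedBall_iff_norm] at h1
    rw [mem_closedBall_iff_norm, Real.norm_eq_abs]
    calc |s - inner ℝ ν x₀| = |inner ℝ ν ((y : E) + s • ν - x₀)| := by
          rw [inner_sub_right, inner_add_smul hν]
      _ ≤ ‖ν‖ * ‖(y : E) + s • ν - x₀‖ := abs_real_inner_le_norm _ _
      _ ≤ r := by rw [hν, one_mul]; exact h1
  have hout : ∀ s : ℝ, (y : E) + s • ν ∉ Metric.closedBall x₀ r →
      fderiv ℝ w ((y : E) + s • ν) ν = 0 := fun s hs => by
    have : fderiv ℝ w ((y : E) + s • ν) = 0 := by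
      by_contra hne
      exact hs (hwr (support_fderiv_subset ℝ hne))
    rw [this]; rfl
  have hout' : ∀ s : ℝ, (y : E) + s • ν ∉ Metric.closedBall x₀ r →
      Ω.indicator (fun x => fderiv ℝ w x ν) ((y : E) + s • ν) = 0 := fun s hs =>
    indicator_apply_eq_zero.2 fun _ => hout s hs
  have hderiv : deriv g = fun s => fderiv ℝ w ((y : E) + s • ν) ν := funext fun s => (hgd s).deriv
  by_cases hy : y ∈ hyperProj ν '' (frontier Ω ∩ Metric.closedBall x₀ r)
  · rw [indicator_of_mem hy]
    obtain ⟨x, hx, rfl⟩ := hy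
    have hxa := hyperProj_add_inner_smul hν x
    rw [← hf x hx] at hxa
    set y := hyperProj ν x
    set a := f y
    have hae : (fun s : ℝ => Ω.indicator (fun x => fderiv ℝ w x ν) ((y : E) + s • ν)) =ᵐ[volume]
        (Iic a).indicator (deriv g) := by
      filter_upwards [compl_mem_ae_iff.2 (measure_singleton a)] with s hs
      have hdiff : (y : E) + s • ν - x = (s - a) • ν := by
        rw [sub_smul]; rw [sub_eq_sub_iff_add_eq_add, ← hxa]; abel
      have hin : inner ℝ ν ((y : E) + s • ν - x) = s - a := by
        rw [hdiff, real_inner_smul_right, real_inner_self_eq_norm_sq, hν]; ring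
      have hno : ‖(y : E) + s • ν - x‖ = |s - a| := by
        rw [hdiff, norm_smul, hν, mul_one, Real.norm_eq_abs]
      rw [hderiv]
      by_cases hz : (y : E) + s • ν ∈ Metric.closedBall x₀ r
      · rcases lt_or_gt_of_ne hs with hlt | hlt
        · rw [indicator_of_mem (show s ∈ Iic a from hlt.le), indicator_of_mem]
          refine h.mem x hx.1 hx.2 _ hz ?_
          rw [hin, hno, abs_of_neg (sub_neg.2 hlt)]
          nlinarith
        · rw [indicator_of_notMem (show s ∉ Iic a from not_le.2 hlt), indicator_of_notMem]
          refine fun hΩ => h.notMem x hx.1 hx.2 _ hz ?_ (subset_closure hΩ)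
          rw [hin, hno, abs_of_pos (sub_pos.2 hlt)]
          nlinarith
      -- Outside the ball nothing is known about `Ω`, but the derivative of `w` vanishes there.
      · rw [hout' s hz, indicator_apply, hout s hz, ite_self]
    rw [integral_congr_ae hae, integral_indicator measurableSet_Iic,
      HasCompactSupport.integral_Iic_deriv_eq hgc hgs]
  · rw [indicator_of_notMem hy]
    set C := Metric.closedBall x₀ r ∩ range (fun s : ℝ => (y : E) + s • ν)
    -- The chord is connected and misses the frontier, so `Ω` and the complement of `closure Ω`
    -- cannot both meet it.
    have hC : IsPreconnected C := by
      have : C = (fun s : ℝ => (y : E) + s • ν) '' ((fun s : ℝ => (y : E) + s • ν) ⁻¹'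
          Metric.closedBall x₀ r) := by
        rw [image_preimage_eq_inter_range]
      rw [this]
      refine IsPreconnected.image ?_ _ (by fun_prop)
      refine Convex.isPreconnected ?_
      have := (convex_closedBall x₀ r).affine_preimage (AffineMap.lineMap (y : E) ((y : E) + ν))
      convert! this using 2 with s
      ext s
      simp [AffineMap.lineMap_apply, add_comm]
    have hCf : C ∩ frontier Ω = ∅ := by
      rw [eq_empty_iff_forall_notMem]
      rintro _ ⟨⟨hz, s, rfl⟩, hzf⟩
      exact hy ⟨_, ⟨hzf, hz⟩, hyperProj_add_smul hν y s⟩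
    by_cases hCΩ : (C ∩ Ω).Nonempty
    · have hsub : C ⊆ Ω := by
        by_contra hns
        obtain ⟨z, hzC, hzΩ⟩ := not_subset.1 hns
        have hcl : ∀ z ∈ C, z ∉ Ω → z ∉ closure Ω := fun z hzC hzΩ hz =>
          eq_empty_iff_forall_notMem.1 hCf z ⟨hzC, by rw [hΩ.frontier_eq]; exact ⟨hz, hzΩ⟩⟩
        obtain ⟨z', -, hz1, hz2⟩ := hC Ω (closure Ω)ᶜ hΩ isClosed_closure.isOpen_compl
          (fun z hz => (em (z ∈ Ω)).imp id (hcl z hz)) hCΩ ⟨z, hzC, hcl z hzC hzΩ⟩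
        exact hz2 (subset_closure hz1)
      have : ∀ s : ℝ, Ω.indicator (fun x => fderiv ℝ w x ν) ((y : E) + s • ν) =
          fderiv ℝ w ((y : E) + s • ν) ν := by
        intro s
        by_cases hz : (y : E) + s • ν ∈ Metric.closedBall x₀ r
        · exact indicator_of_mem (hsub ⟨hz, s, rfl⟩) _
        · rw [hout' s hz, hout s hz]
      simp_rw [this]
      refine integral_eq_zero_of_hasDerivAt_of_integrable hgd ?_
        (hgc.continuous.integrable_of_hasCompactSupport hgs)
      rw [← hderiv]
      exact (hgc.continuous_deriv le_rfl).integrable_of_hasCompactSupport hgs.deriv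
    · have : ∀ s : ℝ, Ω.indicator (fun x => fderiv ℝ w x ν) ((y : E) + s • ν) = 0 := by
        intro s
        by_cases hz : (y : E) + s • ν ∈ Metric.closedBall x₀ r
        · exact indicator_of_notMem (fun hΩ => hCΩ ⟨_, ⟨hz, s, rfl⟩, hΩ⟩) _
        · exact hout' s hz
      simp [this]

variable [FiniteDimensional ℝ E]

theorem isCompact_hyperProj_image (Ω : Set E) (ν x₀ : E) (r : ℝ) :
    IsCompact (hyperProj ν '' (frontier Ω ∩ Metric.closedBall x₀ r)) :=
  ((isCompact_closedBall x₀ r).inter_left isClosed_frontier).image (hyperProj ν).continuous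

variable [MeasurableSpace E] [BorelSpace E]

theorem HasNormalCone.setIntegral_fderiv_eq (h : HasNormalCone Ω ν δ r x₀) (hΩ : IsOpen Ω)
    (hδ1 : δ < 1)
    (hf : ∀ x ∈ frontier Ω ∩ Metric.closedBall x₀ r, f (hyperProj ν x) = inner ℝ ν x)
    (hw : ContDiff ℝ 1 w) (hwr : tsupport w ⊆ Metric.closedBall x₀ r) :
    ∫ x in Ω, fderiv ℝ w x ν =
      ∫ y in hyperProj ν '' (frontier Ω ∩ Metric.closedBall x₀ r), w ((y : E) + f y • ν) := by
  have hwc : HasCompactSupport w := (isCompact_closedBall x₀ r).of_isClosed_subset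
    (isClosed_tsupport w) hwr
  have hint : Integrable (fun x => fderiv ℝ w x ν) :=
    ((hw.continuous_fderiv one_ne_zero).clm_apply continuous_const).integrable_of_hasCompactSupport
      (hwc.fderiv_apply ℝ ν)
  rw [← integral_indicator hΩ.measurableSet,
    integral_eq_integral_hyperplane_integral h.norm_eq (hint.indicator hΩ.measurableSet),
    ← integral_indicator (isCompact_hyperProj_image Ω ν x₀ r).measurableSet]
  exact integral_congr_ae (Eventually.of_forall fun y => h.integral_line hΩ hδ1 hf hw hwr y)

end Flux

/-! ### Hausdorff measure of a Lipschitz graph -/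

theorem _root_.LipschitzWith.euclideanHausdorffMeasure_image_le {X Y : Type*}
    [EMetricSpace X] [MeasurableSpace X] [BorelSpace X]
    [EMetricSpace Y] [MeasurableSpace Y] [BorelSpace Y] {K : ℝ≥0} {f : X → Y}
    (hf : LipschitzWith K f) (d : ℕ) (s : Set X) :
    μHE[d] (f '' s) ≤ (K : ℝ≥0∞) ^ d * μHE[d] s := by
  simp only [Measure.euclideanHausdorffMeasure_def, Measure.smul_apply, ENNReal.smul_def,
    smul_eq_mul]
  rw [mul_left_comm, ← ENNReal.rpow_natCast]
  gcongr
  exact hf.hausdorffMeasure_image_le d.cast_nonneg s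

section SurfaceMeasure

variable {E : Type*} [NormedAddCommGroup E] [InnerProductSpace ℝ E]
  {d : ℕ} {S : Set E} {ν : E} {k : ℝ≥0} {f : (ℝ ∙ ν)ᗮ → ℝ}

theorem lipschitzWith_graph (hν : ‖ν‖ = 1) (hf : LipschitzWith k f) :
    LipschitzWith (1 + k) (fun y : (ℝ ∙ ν)ᗮ => (y : E) + f y • ν) := by
  refine (isometry_subtype_coe.lipschitz).add (LipschitzWith.of_dist_le_mul fun y z => ?_)
  rw [dist_eq_norm, ← sub_smul, norm_smul, hν, mul_one]
  exact hf.dist_le_mul y z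

theorem graph_hyperProj (hν : ‖ν‖ = 1) (hfS : ∀ x ∈ S, f (hyperProj ν x) = inner ℝ ν x) {x : E}
    (hx : x ∈ S) : (hyperProj ν x : E) + f (hyperProj ν x) • ν = x := by
  rw [hfS x hx, hyperProj_add_inner_smul hν]

variable [FiniteDimensional ℝ E] [MeasurableSpace E] [BorelSpace E]

theorem euclideanHausdorffMeasure_hyperplane (hE : Module.finrank ℝ E = d + 1) (hν : ‖ν‖ = 1) :
    (μHE[d] : Measure (ℝ ∙ ν)ᗮ) = volume := by
  have : Module.finrank ℝ (ℝ ∙ ν)ᗮ = d := by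
    have : Fact (Module.finrank ℝ E = d + 1) := ⟨hE⟩
    exact Submodule.finrank_orthogonal_span_singleton (norm_ne_zero_iff.1 (by rw [hν]; simp))
  rw [← this]
  exact InnerProductSpace.euclideanHausdorffMeasure_eq_volume

/-- The projection is `1`-Lipschitz. Together with the reverse estimate for the graph map, this does
the work of the area formula up to a factor close to `1`. -/
theorem volume_restrict_le_map_hyperProj (hE : Module.finrank ℝ E = d + 1) (hν : ‖ν‖ = 1) :
    volume.restrict (hyperProj ν '' S) ≤ ((μHE[d] : Measure E).restrict S).map (hyperProj ν) := by
  have hQ := (hyperProj ν).continuous.measurable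
  refine Measure.le_iff.2 fun B hB => ?_
  rw [Measure.map_apply hQ hB, Measure.restrict_apply hB, Measure.restrict_apply (hQ hB),
    inter_comm B, ← image_inter_preimage, inter_comm S, ← euclideanHausdorffMeasure_hyperplane hE hν]
  have hlip : LipschitzWith 1 (hyperProj ν) := by
    refine (hyperProj ν).lipschitz.weaken ?_
    exact_mod_cast Submodule.orthogonalProjectionOnto_norm_le _
  simpa using hlip.euclideanHausdorffMeasure_image_le d (hyperProj ν ⁻¹' B ∩ S)

theorem restrict_le_smul_map_graph (hE : Module.finrank ℝ E = d + 1) (hν : ‖ν‖ = 1)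
    (hf : LipschitzWith k f) (hfS : ∀ x ∈ S, f (hyperProj ν x) = inner ℝ ν x) :
    (μHE[d] : Measure E).restrict S ≤ (1 + (k : ℝ≥0∞)) ^ d •
      (volume.restrict (hyperProj ν '' S)).map (fun y : (ℝ ∙ ν)ᗮ => (y : E) + f y • ν) := by
  have hlip := lipschitzWith_graph hν hf
  have hg := hlip.continuous.measurable
  refine Measure.le_iff.2 fun B hB => ?_
  rw [Measure.smul_apply, Measure.map_apply hg hB, Measure.restrict_apply hB,
    Measure.restrict_apply (hg hB), ← euclideanHausdorffMeasure_hyperplane hE hν, smul_eq_mul]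
  refine (measure_mono ?_).trans (by
    simpa using hlip.euclideanHausdorffMeasure_image_le d
      ((fun y : (ℝ ∙ ν)ᗮ => (y : E) + f y • ν) ⁻¹' B ∩ hyperProj ν '' S))
  rintro x ⟨hxB, hxS⟩
  exact ⟨hyperProj ν x, ⟨by rwa [mem_preimage, graph_hyperProj hν hfS hxS], mem_image_of_mem _ hxS⟩,
    graph_hyperProj hν hfS hxS⟩

theorem euclideanHausdorffMeasure_lt_top_of_graph (hE : Module.finrank ℝ E = d + 1) (hν : ‖ν‖ = 1)
    (hf : LipschitzWith k f) (hfS : ∀ x ∈ S, f (hyperProj ν x) = inner ℝ ν x)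
    (hS : IsCompact S) : (μHE[d] : Measure E) S < ⊤ := by
  have h := Measure.le_iff'.1 (restrict_le_smul_map_graph hE hν hf hfS) univ
  rw [Measure.restrict_apply_univ, Measure.smul_apply, Measure.map_apply
    (lipschitzWith_graph hν hf).continuous.measurable .univ, preimage_univ,
    Measure.restrict_apply_univ] at h
  refine h.trans_lt (ENNReal.mul_lt_top (by finiteness) ?_)
  exact (hS.image (hyperProj ν).continuous).measure_lt_top

theorem setIntegral_graph_le (hE : Module.finrank ℝ E = d + 1) (hν : ‖ν‖ = 1)
    (hf : LipschitzWith k f) (hfS : ∀ x ∈ S, f (hyperProj ν x) = inner ℝ ν x)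
    (hS : IsCompact S) {w : E → ℝ} (hw : Continuous w) (hw0 : ∀ x, 0 ≤ w x) :
    ∫ y in hyperProj ν '' S, w ((y : E) + f y • ν) ≤ ∫ x in S, w x ∂μHE[d] := by
  have hQ := (hyperProj ν).continuous
  have hg := (lipschitzWith_graph hν hf).continuous
  have hfin := euclideanHausdorffMeasure_lt_top_of_graph hE hν hf hfS hS
  have heq : ∀ x ∈ S, w ((hyperProj ν x : E) + f (hyperProj ν x) • ν) = w x :=
    fun x hx => by rw [graph_hyperProj hν hfS hx]
  calc ∫ y in hyperProj ν '' S, w ((y : E) + f y • ν)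
      ≤ ∫ y, w ((y : E) + f y • ν) ∂((μHE[d] : Measure E).restrict S).map (hyperProj ν) := by
        refine integral_mono_measure (volume_restrict_le_map_hyperProj hE hν)
          (Eventually.of_forall fun y => hw0 _) ?_
        refine (integrable_map_measure (hw.comp hg).aestronglyMeasurable hQ.aemeasurable).2 ?_
        refine IntegrableOn.congr_fun (f := w) ?_ (fun x hx => (heq x hx).symm) hS.measurableSet
        exact hw.continuousOn.integrableOn_of_subset_isCompact hS hS.measurableSet le_rfl hfin.ne
    _ = ∫ x in S, w ((hyperProj ν x : E) + f (hyperProj ν x) • ν) ∂μHE[d] :=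
        integral_map hQ.aemeasurable (hw.comp hg).aestronglyMeasurable
    _ = ∫ x in S, w x ∂μHE[d] := setIntegral_congr_fun hS.measurableSet heq

theorem setIntegral_le_mul_setIntegral_graph (hE : Module.finrank ℝ E = d + 1) (hν : ‖ν‖ = 1)
    (hf : LipschitzWith k f) (hfS : ∀ x ∈ S, f (hyperProj ν x) = inner ℝ ν x)
    (hS : IsCompact S) {w : E → ℝ} (hw : Continuous w) (hw0 : ∀ x, 0 ≤ w x) :
    ∫ x in S, w x ∂μHE[d] ≤ (1 + (k : ℝ)) ^ d * ∫ y in hyperProj ν '' S, w ((y : E) + f y • ν) := by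
  have hg := (lipschitzWith_graph hν hf).continuous
  have hint : IntegrableOn (fun y : (ℝ ∙ ν)ᗮ => w ((y : E) + f y • ν)) (hyperProj ν '' S) :=
    (hw.comp hg).continuousOn.integrableOn_compact (hS.image (hyperProj ν).continuous)
  have hint' := (integrable_map_measure hw.aestronglyMeasurable hg.aemeasurable).2 hint
  refine (integral_mono_measure (restrict_le_smul_map_graph hE hν hf hfS)
    (Eventually.of_forall hw0) (hint'.smul_measure (by finiteness))).trans_eq ?_
  rw [integral_smul_measure, integral_map hg.aemeasurable hw.aestronglyMeasurable, smul_eq_mul]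
  rw [ENNReal.toReal_pow, ENNReal.toReal_add (by simp) (by simp)]
  simp

end SurfaceMeasure

/-! ### Boundary integral and normal derivative near a boundary point -/

section Trace

variable {E : Type*} [NormedAddCommGroup E] [InnerProductSpace ℝ E] [FiniteDimensional ℝ E]
  [MeasurableSpace E] [BorelSpace E]
  {d : ℕ} {Ω : Set E} {ν x₀ : E} {δ r : ℝ} {k : ℝ≥0} {w : E → ℝ}

theorem HasNormalCone.measure_lt_top (h : HasNormalCone Ω ν δ r x₀) (hΩ : IsOpen Ω)
    (hE : Module.finrank ℝ E = d + 1) (hδ : 0 ≤ δ) (hδ1 : δ < 1)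
    (hk : δ ^ 2 * (1 + (k : ℝ) ^ 2) ≤ (k : ℝ) ^ 2) :
    (μHE[d] : Measure E) (frontier Ω ∩ Metric.closedBall x₀ r) < ⊤ := by
  obtain ⟨f, hf, hfS⟩ := h.exists_height hΩ hδ hk hδ1
  exact euclideanHausdorffMeasure_lt_top_of_graph hE h.norm_eq hf hfS
    ((isCompact_closedBall x₀ r).inter_left isClosed_frontier)

/-- Two-sided comparison of the boundary integral of a function supported near a boundary point
with the integral of its normal derivative. -/
theorem HasNormalCone.setIntegral_frontier (h : HasNormalCone Ω ν δ r x₀) (hΩ : IsOpen Ω)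
    (hE : Module.finrank ℝ E = d + 1) (hδ : 0 ≤ δ) (hδ1 : δ < 1)
    (hk : δ ^ 2 * (1 + (k : ℝ) ^ 2) ≤ (k : ℝ) ^ 2) (hw : ContDiff ℝ 1 w) (hw0 : ∀ x, 0 ≤ w x)
    (hwr : tsupport w ⊆ Metric.closedBall x₀ r) :
    ∫ x in Ω, fderiv ℝ w x ν ≤ ∫ x in frontier Ω, w x ∂μHE[d] ∧
    ∫ x in frontier Ω, w x ∂μHE[d] ≤ (1 + (k : ℝ)) ^ d * ∫ x in Ω, fderiv ℝ w x ν := by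
  obtain ⟨f, hf, hfS⟩ := h.exists_height hΩ hδ hk hδ1
  have hS : IsCompact (frontier Ω ∩ Metric.closedBall x₀ r) :=
    (isCompact_closedBall x₀ r).inter_left isClosed_frontier
  have hrest : ∫ x in frontier Ω, w x ∂μHE[d] =
      ∫ x in frontier Ω ∩ Metric.closedBall x₀ r, w x ∂μHE[d] := by
    refine setIntegral_eq_of_subset_of_forall_sdiff_eq_zero isClosed_frontier.measurableSet
      inter_subset_left fun x hx => ?_
    by_contra hne
    exact hx.2 ⟨hx.1, hwr (subset_tsupport w hne)⟩
  rw [hrest, h.setIntegral_fderiv_eq hΩ hδ1 hfS hw hwr]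
  exact ⟨setIntegral_graph_le hE h.norm_eq hf hfS hS hw.continuous hw0,
    setIntegral_le_mul_setIntegral_graph hE h.norm_eq hf hfS hS hw.continuous hw0⟩

end Trace

/-! ### Global trace inequality by a partition of unity -/

section GlobalTrace

open scoped Manifold

variable {E : Type*} [NormedAddCommGroup E] [InnerProductSpace ℝ E] {Ω : Set E}

/-- Every boundary point has normal cones of arbitrarily small slope. -/
def HasNormalCones (Ω : Set E) : Prop :=
  ∀ x ∈ frontier Ω, ∀ δ > 0, ∃ ν, ∃ r > 0, HasNormalCone Ω ν δ r x

theorem exists_slope {k : ℝ} (hk : 0 < k) :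
    ∃ δ > 0, δ < 1 ∧ δ ^ 2 * (1 + k ^ 2) ≤ k ^ 2 := by
  refine ⟨k / (1 + k), by positivity, (div_lt_one (by positivity)).2 (by linarith), ?_⟩
  rw [div_pow, div_mul_eq_mul_div, div_le_iff₀ (by positivity)]
  gcongr
  nlinarith

variable [FiniteDimensional ℝ E]

theorem isCompact_frontier_of_isBounded (hb : Bornology.IsBounded Ω) : IsCompact (frontier Ω) :=
  Metric.isCompact_of_isClosed_isBounded isClosed_frontier (hb.closure.subset frontier_subset_closure)

variable [MeasurableSpace E] [BorelSpace E] {d : ℕ}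

theorem _root_.Continuous.integrableOn_of_isBounded {F : Type*} [NormedAddCommGroup F] {f : E → F}
    (hf : Continuous f) {s : Set E} (hs : Bornology.IsBounded s) : IntegrableOn f s :=
  (hf.continuousOn.integrableOn_compact hs.isCompact_closure).mono_set subset_closure

theorem HasNormalCones.measure_frontier_lt_top (h : HasNormalCones Ω) (hΩ : IsOpen Ω)
    (hb : Bornology.IsBounded Ω) (hE : Module.finrank ℝ E = d + 1) :
    (μHE[d] : Measure E) (frontier Ω) < ⊤ := by
  obtain ⟨δ, hδ, hδ1, hk⟩ := exists_slope one_pos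
  choose! ν r hr hc using fun x hx => h x hx δ hδ
  obtain ⟨t, htf, ht⟩ := (isCompact_frontier_of_isBounded hb).elim_nhds_subcover
    (fun x => Metric.closedBall x (r x)) fun x hx => Metric.closedBall_mem_nhds x (hr x hx)
  refine lt_of_le_of_lt (measure_mono (t := ⋃ x ∈ t, frontier Ω ∩ Metric.closedBall x (r x)) ?_)
    (measure_biUnion_lt_top t.finite_toSet fun x hx =>
      (hc x (htf x hx)).measure_lt_top (k := 1) hΩ hE hδ.le hδ1 (by simpa using hk))
  rw [← inter_iUnion₂]
  exact subset_inter le_rfl ht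

theorem HasNormalCones.integrableOn_frontier (h : HasNormalCones Ω) (hΩ : IsOpen Ω)
    (hb : Bornology.IsBounded Ω) (hE : Module.finrank ℝ E = d + 1) {f : E → ℝ} (hf : Continuous f) :
    IntegrableOn f (frontier Ω) μHE[d] :=
  hf.continuousOn.integrableOn_of_subset_isCompact (isCompact_frontier_of_isBounded hb)
    isClosed_frontier.measurableSet le_rfl (h.measure_frontier_lt_top hΩ hb hE).ne

/-- A trace inequality in `W^{1,1}` with leading constant arbitrarily close to `1`. -/
theorem HasNormalCones.exists_trace_inequality (h : HasNormalCones Ω) (hΩ : IsOpen Ω)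
    (hb : Bornology.IsBounded Ω) (hE : Module.finrank ℝ E = d + 1) {L : ℝ} (hL : 1 < L) :
    ∃ C, 0 ≤ C ∧ ∀ w : E → ℝ, ContDiff ℝ 1 w → (∀ x, 0 ≤ w x) →
      ∫ x in frontier Ω, w x ∂μHE[d] ≤
        L * (∫ x in Ω, ‖fderiv ℝ w x‖) + C * ∫ x in Ω, w x := by
  -- The only loss in the leading constant is the factor `(1 + k)^d` of the graph map; `k` and then
  -- `δ` are taken small enough for `L`.
  obtain ⟨k, hk0, hkL⟩ : ∃ k : ℝ≥0, 0 < (k : ℝ) ∧ (1 + (k : ℝ)) ^ d ≤ L := by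
    have hev : ∀ᶠ k : ℝ in 𝓝[>] 0, (1 + k) ^ d < L := by
      refine nhdsWithin_le_nhds (ContinuousAt.eventually_lt (by fun_prop) continuousAt_const ?_)
      simpa using hL
    obtain ⟨k, hk, hk0⟩ := (hev.and self_mem_nhdsWithin).exists
    exact ⟨⟨k, le_of_lt hk0⟩, hk0, hk.le⟩
  obtain ⟨δ, hδ, hδ1, hk⟩ := exists_slope hk0
  choose! ν r hr hc using fun x hx => h x hx δ hδ
  obtain ⟨t, htf, ht⟩ := (isCompact_frontier_of_isBounded hb).elim_nhds_subcover
    (fun x => Metric.ball x (r x)) fun x hx => Metric.ball_mem_nhds x (hr x hx)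
  obtain ⟨f, hf⟩ := SmoothPartitionOfUnity.exists_isSubordinate 𝓘(ℝ, E)
    (isClosed_frontier (s := Ω)) (fun i : t => Metric.ball (i : E) (r i))
    (fun i => Metric.isOpen_ball) (by
      rintro x hx
      obtain ⟨i, hi, hxi⟩ := mem_iUnion₂.1 (ht hx)
      exact mem_iUnion.2 ⟨⟨i, hi⟩, hxi⟩)
  have hfc : ∀ i, ContDiff ℝ 1 (f i) := fun i =>
    ((f i).contMDiff.contDiff).of_le (by simp)
  have hfcs : ∀ i, HasCompactSupport (f i) := fun i =>
    (isCompact_closedBall (i : E) (r i)).of_isClosed_subset (isClosed_tsupport _)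
      ((hf i).trans Metric.ball_subset_closedBall)
  have hbd : ∀ i, ∃ K, ∀ x, ‖fderiv ℝ (f i) x‖ ≤ K := fun i =>
    ((hfc i).continuous_fderiv one_ne_zero).bounded_above_of_compact_support ((hfcs i).fderiv ℝ)
  choose K hK using hbd
  have hK0 : ∀ i, 0 ≤ K i := fun i => (norm_nonneg _).trans (hK i 0)
  -- Derivatives of the partition functions fall only on the zero-order term, so `C` collects their
  -- bounds `K i`.
  refine ⟨L * ∑ i, K i, mul_nonneg (by linarith) (Finset.sum_nonneg fun i _ => hK0 i),
    fun w hw hw0 => ?_⟩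
  have hwd := hw.differentiable one_ne_zero
  have hdw : Continuous fun x => ‖fderiv ℝ w x‖ := (hw.continuous_fderiv one_ne_zero).norm
  have hloc : ∀ i, ∫ x in frontier Ω, f i x * w x ∂μHE[d] ≤
      L * ∫ x in Ω, (f i x * ‖fderiv ℝ w x‖ + K i * w x) := by
    intro i
    have hi := hc i (htf i i.2)
    have hle : ∀ x, fderiv ℝ (fun x => f i x * w x) x (ν i) ≤
        f i x * ‖fderiv ℝ w x‖ + K i * w x := by
      intro x
      rw [fderiv_fun_mul ((hfc i).differentiable one_ne_zero x) (hwd x)]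
      have h1 : fderiv ℝ w x (ν i) ≤ ‖fderiv ℝ w x‖ := by
        simpa [hi.norm_eq] using (le_abs_self _).trans ((fderiv ℝ w x).le_opNorm (ν i))
      have h2 : fderiv ℝ (f i) x (ν i) ≤ K i := by
        refine le_trans ?_ (hK i x)
        simpa [hi.norm_eq] using (le_abs_self _).trans ((fderiv ℝ (f i) x).le_opNorm (ν i))
      have h3 := mul_le_mul_of_nonneg_left h1 (f.nonneg i x)
      have h4 := mul_le_mul_of_nonneg_left h2 (hw0 x)
      simp only [add_apply, smul_apply, smul_eq_mul]
      linarith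
    have hfw : ContDiff ℝ 1 fun x => f i x * w x := (hfc i).mul hw
    have hint : ∫ x in Ω, fderiv ℝ (fun x => f i x * w x) x (ν i) ≤
        ∫ x in Ω, (f i x * ‖fderiv ℝ w x‖ + K i * w x) := by
      refine setIntegral_mono ?_ ?_ hle
      · exact Continuous.integrableOn_of_isBounded
          ((hfw.continuous_fderiv one_ne_zero).clm_apply continuous_const) hb
      · exact Continuous.integrableOn_of_isBounded
          (((hfc i).continuous.mul hdw).add (continuous_const.mul hw.continuous)) hb
    have hnn : 0 ≤ ∫ x in Ω, (f i x * ‖fderiv ℝ w x‖ + K i * w x) :=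
      integral_nonneg fun x => add_nonneg (mul_nonneg (f.nonneg i x) (norm_nonneg _))
        (mul_nonneg (hK0 i) (hw0 x))
    refine ((hi.setIntegral_frontier hΩ hE hδ.le hδ1 hk hfw
      (fun x => mul_nonneg (f.nonneg i x) (hw0 x)) ?_).2).trans ?_
    · exact (tsupport_mul_subset_left).trans ((hf i).trans Metric.ball_subset_closedBall)
    · exact (mul_le_mul_of_nonneg_left hint (by positivity)).trans
        (mul_le_mul_of_nonneg_right hkL hnn)
  have hsum : ∀ x ∈ frontier Ω, w x = ∑ i, f i x * w x := by
    intro x hx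
    have := f.sum_eq_one hx
    rw [finsum_eq_sum_of_fintype] at this
    rw [← Finset.sum_mul, this, one_mul]
  have hI1 : ∀ i, IntegrableOn (fun x => f i x * ‖fderiv ℝ w x‖) Ω := fun i =>
    Continuous.integrableOn_of_isBounded ((hfc i).continuous.mul hdw) hb
  have hI2 : ∀ i, IntegrableOn (fun x => K i * w x) Ω := fun i =>
    Continuous.integrableOn_of_isBounded (continuous_const.mul hw.continuous) hb
  calc ∫ x in frontier Ω, w x ∂μHE[d]
      = ∑ i, ∫ x in frontier Ω, f i x * w x ∂μHE[d] := by
        rw [setIntegral_congr_fun isClosed_frontier.measurableSet hsum, integral_finsetSum]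
        exact fun i _ => h.integrableOn_frontier hΩ hb hE ((hfc i).continuous.mul hw.continuous)
    _ ≤ ∑ i, L * ∫ x in Ω, (f i x * ‖fderiv ℝ w x‖ + K i * w x) :=
        Finset.sum_le_sum fun i _ => hloc i
    _ = L * (∫ x in Ω, ∑ i, f i x * ‖fderiv ℝ w x‖) + (L * ∑ i, K i) * ∫ x in Ω, w x := by
        rw [← Finset.mul_sum, mul_assoc, ← mul_add, integral_finsetSum _ fun i _ => hI1 i,
          Finset.sum_mul, ← Finset.sum_add_distrib]
        congr 1
        refine Finset.sum_congr rfl fun i _ => ?_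
        rw [integral_add (hI1 i) (hI2 i), integral_const_mul]
    _ ≤ L * (∫ x in Ω, ‖fderiv ℝ w x‖) + (L * ∑ i, K i) * ∫ x in Ω, w x := by
        -- The gradient terms recombine because the partition functions sum to at most `1`
        -- everywhere; the number of balls does not enter the leading constant.
        refine add_le_add (mul_le_mul_of_nonneg_left ?_ (by linarith)) le_rfl
        refine setIntegral_mono (integrable_finsetSum _ fun i _ => hI1 i)
          (Continuous.integrableOn_of_isBounded hdw hb) fun x => ?_
        have := f.sum_le_one x
        rw [finsum_eq_sum_of_fintype] at this
        simp only
        rw [← Finset.sum_mul]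
        exact mul_le_of_le_one_left (norm_nonneg _) this

end GlobalTrace

/-! ### Gradients, Young's inequality and convergence of `p`-th powers -/

theorem norm_gradient {E : Type*} [NormedAddCommGroup E] [InnerProductSpace ℝ E] [CompleteSpace E]
    (v : E → ℝ) (x : E) : ‖gradient v x‖ = ‖fderiv ℝ v x‖ := by
  rw [← toDual_gradient, LinearIsometryEquiv.norm_map]

theorem inner_gradient {E : Type*} [NormedAddCommGroup E] [InnerProductSpace ℝ E] [CompleteSpace E]
    (v : E → ℝ) (x z : E) : inner ℝ (gradient v x) z = fderiv ℝ v x z := by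
  rw [← toDual_gradient, InnerProductSpace.toDual_apply_apply]

theorem continuous_gradient {E : Type*} [NormedAddCommGroup E] [InnerProductSpace ℝ E]
    [CompleteSpace E] {v : E → ℝ} (hv : ContDiff ℝ 1 v) : Continuous (gradient v) :=
  (InnerProductSpace.toDual ℝ E).symm.continuous.comp (hv.continuous_fderiv one_ne_zero)

/-- Young's inequality for `b` and `c a^(p-1)`, multiplied by `p`. It is the source of the constant
`p - 1` and the exponent `p / (p - 1)`. -/
theorem mul_rpow_mul_le_add {p : ℝ} (hp : 1 < p) {a b c : ℝ} (ha : 0 ≤ a) (hb : 0 ≤ b)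
    (hc : 0 ≤ c) :
    c * (p * a ^ (p - 1) * b) ≤ b ^ p + (p - 1) * c ^ (p / (p - 1)) * a ^ p := by
  have hpq : p.HolderConjugate (p / (p - 1)) := Real.HolderConjugate.conjExponent hp
  have h := Real.young_inequality_of_nonneg hb
    (mul_nonneg hc (Real.rpow_nonneg ha (p - 1))) hpq
  have hp1 : p - 1 ≠ 0 := by linarith
  rw [Real.mul_rpow hc (Real.rpow_nonneg ha _), ← Real.rpow_mul ha, mul_div_cancel₀ _ hp1] at h
  have h2 := mul_le_mul_of_nonneg_left h (show 0 ≤ p by linarith)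
  have h3 : p * (b ^ p / p + c ^ (p / (p - 1)) * a ^ p / (p / (p - 1))) =
      b ^ p + (p - 1) * c ^ (p / (p - 1)) * a ^ p := by
    field_simp
  rw [h3] at h2
  linarith

theorem tendsto_integral_norm_rpow {X F : Type*} [MeasurableSpace X] {μ : Measure X}
    [NormedAddCommGroup F] {p : ℝ} (hp : 1 ≤ p) {v : ℕ → X → F} {u : X → F}
    (hv : ∀ n, MemLp (v n) (ENNReal.ofReal p) μ) (hu : MemLp u (ENNReal.ofReal p) μ)
    (h : Tendsto (fun n => eLpNorm (fun x => v n x - u x) (ENNReal.ofReal p) μ) atTop (𝓝 0)) :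
    Tendsto (fun n => ∫ x, ‖v n x‖ ^ p ∂μ) atTop (𝓝 (∫ x, ‖u x‖ ^ p ∂μ)) := by
  have hp0 : 0 < p := by linarith
  have hfact : Fact (1 ≤ ENNReal.ofReal p) := ⟨by simpa using hp⟩
  have heq : ∀ f : X → F, MemLp f (ENNReal.ofReal p) μ →
      ∫ x, ‖f x‖ ^ p ∂μ = (eLpNorm f (ENNReal.ofReal p) μ).toReal ^ p := by
    intro f hf
    rw [hf.eLpNorm_eq_integral_rpow_norm (by simpa using hp0) ENNReal.ofReal_ne_top,
      ENNReal.toReal_ofReal hp0.le, ENNReal.toReal_ofReal (by positivity),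
      ← Real.rpow_mul (by positivity), inv_mul_cancel₀ hp0.ne', Real.rpow_one]
  simp only [fun n => heq _ (hv n), heq _ hu]
  refine Tendsto.rpow_const ?_ (Or.inr hp0.le)
  have := (Lp.tendsto_Lp_iff_tendsto_eLpNorm'' v hv u hu).2 h
  simpa only [Lp.norm_toLp] using this.norm

/-! ### Lower bound for the Rayleigh quotient -/

section Bounds

variable {d : ℕ} {Ω : Set (EuclideanSpace ℝ (Fin (d + 1)))} {p : ℝ}

/-- The trace inequality is applied to `|v|^p`, whose gradient is at most `p|v|^(p-1)|∇v|`; Young's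
inequality with `c = L * α` splits the product. -/
theorem HasNormalCones.exists_robin_inequality (h : HasNormalCones Ω) (hΩ : IsOpen Ω)
    (hb : Bornology.IsBounded Ω) (hp : 1 < p) {L : ℝ} (hL : 1 < L) :
    ∃ C, 0 ≤ C ∧ ∀ α > 0, ∀ v : EuclideanSpace ℝ (Fin (d + 1)) → ℝ, ContDiff ℝ 1 v →
      α * ∫ x, |v x| ^ p ∂(surfaceMeasure Ω) ≤ (∫ x in Ω, ‖gradient v x‖ ^ p) +
        ((p - 1) * (L * α) ^ (p / (p - 1)) + C * α) * ∫ x in Ω, |v x| ^ p := by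
  obtain ⟨C, hC, hCw⟩ := h.exists_trace_inequality hΩ hb (d := d) (by simp) hL
  refine ⟨C, hC, fun α hα v hv => ?_⟩
  have hw : ContDiff ℝ 1 fun x => |v x| ^ p := hv.norm_rpow hp
  have h1 := hCw _ hw fun x => by positivity
  have hwd : Continuous fun x => ‖fderiv ℝ (fun x => |v x| ^ p) x‖ :=
    (hw.continuous_fderiv one_ne_zero).norm
  have hI1 : IntegrableOn (fun x => ‖gradient v x‖ ^ p) Ω :=
    Continuous.integrableOn_of_isBounded
      ((continuous_gradient hv).norm.rpow_const fun _ => Or.inr (by linarith)) hb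
  have hI2 : IntegrableOn (fun x => (p - 1) * (L * α) ^ (p / (p - 1)) * |v x| ^ p) Ω :=
    Continuous.integrableOn_of_isBounded (continuous_const.mul hw.continuous) hb
  have h2 : L * α * ∫ x in Ω, ‖fderiv ℝ (fun x => |v x| ^ p) x‖ ≤
      ∫ x in Ω, (‖gradient v x‖ ^ p + (p - 1) * (L * α) ^ (p / (p - 1)) * |v x| ^ p) := by
    rw [← integral_const_mul]
    refine setIntegral_mono (Continuous.integrableOn_of_isBounded (continuous_const.mul hwd) hb)
      (hI1.add hI2) fun x => ?_
    refine (mul_le_mul_of_nonneg_left (norm_fderiv_norm_rpow_le (hv.differentiable one_ne_zero) hp)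
      (by positivity)).trans ?_
    rw [norm_gradient]
    exact mul_rpow_mul_le_add hp (norm_nonneg _) (norm_nonneg _) (by positivity)
  rw [integral_add hI1 hI2, integral_const_mul] at h2
  have h3 := mul_le_mul_of_nonneg_left h1 hα.le
  simp only [surfaceMeasure]
  linarith

theorem memLp_restrict_of_continuous {F : Type*} [NormedAddCommGroup F]
    {μ : Measure (EuclideanSpace ℝ (Fin (d + 1)))} {s : Set (EuclideanSpace ℝ (Fin (d + 1)))}
    (hs : Bornology.IsBounded s) (hμ : μ s < ⊤) (hsm : MeasurableSet s)
    {v : EuclideanSpace ℝ (Fin (d + 1)) → F} (hv : Continuous v) (q : ℝ≥0∞) :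
    MemLp v q (μ.restrict s) := by
  have : IsFiniteMeasure (μ.restrict s) := ⟨by simpa using hμ⟩
  obtain ⟨K, hK⟩ := hs.isCompact_closure.exists_bound_of_continuousOn hv.continuousOn
  refine MemLp.of_bound hv.aestronglyMeasurable K ?_
  filter_upwards [ae_restrict_mem hsm] with x hx using hK x (subset_closure hx)

theorem HasNormalCones.memLp_surfaceMeasure (h : HasNormalCones Ω) (hΩ : IsOpen Ω)
    (hb : Bornology.IsBounded Ω) {v : EuclideanSpace ℝ (Fin (d + 1)) → ℝ} (hv : Continuous v)
    (q : ℝ≥0∞) : MemLp v q (surfaceMeasure Ω) :=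
  memLp_restrict_of_continuous (isCompact_frontier_of_isBounded hb).isBounded
    (h.measure_frontier_lt_top hΩ hb (by simp)) isClosed_frontier.measurableSet hv q

theorem memLp_restrict_of_isBounded {F : Type*} [NormedAddCommGroup F] (hΩ : IsOpen Ω)
    (hb : Bornology.IsBounded Ω) {v : EuclideanSpace ℝ (Fin (d + 1)) → F} (hv : Continuous v)
    (q : ℝ≥0∞) : MemLp v q (volume.restrict Ω) :=
  memLp_restrict_of_continuous hb hb.measure_lt_top hΩ.measurableSet hv q

/-- The `C¹` functions that define the trace satisfy the Robin inequality, and all three of its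
integrals converge along them. -/
theorem HasNormalCones.exists_le_of_mem_rayleighValues (h : HasNormalCones Ω) (hΩ : IsOpen Ω)
    (hb : Bornology.IsBounded Ω) (hp : 1 < p) {L : ℝ} (hL : 1 < L) :
    ∃ C, 0 ≤ C ∧ ∀ α > 0, ∀ q ∈ rayleighValues p Ω α,
      -((p - 1) * (L * α) ^ (p / (p - 1)) + C * α) ≤ q := by
  obtain ⟨C, hC, hCv⟩ := h.exists_robin_inequality hΩ hb hp hL
  refine ⟨C, hC, fun α hα q hq => ?_⟩
  obtain ⟨u, G, g, ⟨hu, hG, -⟩, ⟨hg, v, hv, hvu, hvG, hvg⟩, hu0, rfl⟩ := hq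
  have hp0 : 0 < p := by linarith
  have t1 := tendsto_integral_norm_rpow hp.le
    (fun n => memLp_restrict_of_isBounded hΩ hb (hv n).continuous _) hu hvu
  have t2 := tendsto_integral_norm_rpow hp.le
    (fun n => memLp_restrict_of_isBounded hΩ hb (continuous_gradient (hv n)) _) hG hvG
  have t3 := tendsto_integral_norm_rpow hp.le
    (fun n => h.memLp_surfaceMeasure hΩ hb (hv n).continuous _) hg hvg
  have key := le_of_tendsto_of_tendsto' (t3.const_mul α)
    (t2.add (t1.const_mul ((p - 1) * (L * α) ^ (p / (p - 1)) + C * α)))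
    fun n => hCv α hα (v n) (hv n)
  simp only [Real.norm_eq_abs] at key
  have hpos : 0 < ∫ x in Ω, |u x| ^ p := by
    have hi := hu.integrable_norm_rpow (by simpa using hp0) ENNReal.ofReal_ne_top
    rw [ENNReal.toReal_ofReal hp0.le] at hi
    refine lt_of_le_of_ne (integral_nonneg fun x => by positivity) fun h0 => hu0 ?_
    have := (integral_eq_zero_iff_of_nonneg (fun x => by positivity) hi).1 h0.symm
    filter_upwards [this] with x hx
    simpa [Real.rpow_eq_zero_iff_of_nonneg, hp0.ne'] using hx
  rw [le_div_iff₀ hpos]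
  linarith

theorem isSobolevWithGradient_of_contDiff (hΩ : IsOpen Ω) (hb : Bornology.IsBounded Ω)
    {v : EuclideanSpace ℝ (Fin (d + 1)) → ℝ} (hv : ContDiff ℝ 1 v) :
    IsSobolevWithGradient p Ω v (gradient v) := by
  refine ⟨memLp_restrict_of_isBounded hΩ hb hv.continuous _,
    memLp_restrict_of_isBounded hΩ hb (continuous_gradient hv) _, fun ψ hψ hψc hψΩ => ?_⟩
  have hψ1 : ContDiff ℝ 1 ψ := hψ.of_le (by simp)
  have hI1 : Integrable fun x => v x • gradient ψ x := by
    refine (hv.continuous.smul (continuous_gradient hψ1)).integrable_of_hasCompactSupport ?_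
    refine HasCompactSupport.smul_left ?_
    exact (hψc.fderiv ℝ).comp_left
      (g := (InnerProductSpace.toDual ℝ (EuclideanSpace ℝ (Fin (d + 1)))).symm) (map_zero _)
  have hI2 : Integrable fun x => ψ x • gradient v x :=
    (hψ1.continuous.smul (continuous_gradient hv)).integrable_of_hasCompactSupport hψc.smul_right
  have h0 : ∀ x ∉ Ω, ψ x = 0 := fun x hx => image_eq_zero_of_notMem_tsupport fun h => hx (hψΩ h)
  have h0' : ∀ x ∉ Ω, gradient ψ x = 0 := fun x hx => by
    rw [← norm_eq_zero, norm_gradient, norm_eq_zero]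
    by_contra hne
    exact hx (hψΩ (support_fderiv_subset ℝ hne))
  rw [setIntegral_eq_integral_of_forall_compl_eq_zero fun x hx => by rw [h0' x hx, smul_zero],
    setIntegral_eq_integral_of_forall_compl_eq_zero fun x hx => by rw [h0 x hx, zero_smul]]
  -- Pairing with a fixed vector reduces the identity to scalar integration by parts in one
  -- direction.
  refine ext_inner_right (𝕜 := ℝ) fun z => ?_
  rw [inner_neg_left, real_inner_comm z, real_inner_comm z, ← integral_inner hI1, ← integral_inner hI2]
  have e1 : ∀ x, inner ℝ z (v x • gradient ψ x) = v x * fderiv ℝ ψ x z := fun x => by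
    rw [real_inner_smul_right, real_inner_comm, inner_gradient]
  have e2 : ∀ x, inner ℝ z (ψ x • gradient v x) = fderiv ℝ v x z * ψ x := fun x => by
    rw [real_inner_smul_right, real_inner_comm, inner_gradient, mul_comm]
  have hI1' := hI1.const_inner (𝕜 := ℝ) z
  have hI2' := hI2.const_inner (𝕜 := ℝ) z
  simp only [e1, e2] at hI1' hI2' ⊢
  exact integral_mul_fderiv_eq_neg_fderiv_mul_of_integrable hI2' hI1'
    ((hv.continuous.mul hψ1.continuous).integrable_of_hasCompactSupport hψc.mul_left)
    (fun x _ => hv.differentiable one_ne_zero x) (fun x _ => hψ1.differentiable one_ne_zero x)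

theorem HasNormalCones.mem_rayleighValues_of_contDiff (h : HasNormalCones Ω) (hΩ : IsOpen Ω)
    (hb : Bornology.IsBounded Ω) {v : EuclideanSpace ℝ (Fin (d + 1)) → ℝ} (hv : ContDiff ℝ 1 v)
    (hv0 : ∃ x ∈ Ω, v x ≠ 0) (α : ℝ) :
    ((∫ x in Ω, ‖gradient v x‖ ^ p) - α * ∫ x, |v x| ^ p ∂(surfaceMeasure Ω)) /
      ∫ x in Ω, |v x| ^ p ∈ rayleighValues p Ω α :=
  ⟨v, gradient v, v, isSobolevWithGradient_of_contDiff hΩ hb hv,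
    ⟨h.memLp_surfaceMeasure hΩ hb hv.continuous _, fun _ => v, fun _ => hv, by simp, by simp,
      by simp⟩, fun h0 => hv0.elim fun x hx => hx.2 (Measure.eqOn_open_of_ae_eq h0 hΩ
      hv.continuous.continuousOn continuousOn_const hx.1), rfl⟩

theorem HasNormalCones.rayleighValues_nonempty (h : HasNormalCones Ω) (hΩ : IsOpen Ω)
    (hb : Bornology.IsBounded Ω) (hne : Ω.Nonempty) (α : ℝ) : (rayleighValues p Ω α).Nonempty := by
  exact ⟨_, h.mem_rayleighValues_of_contDiff hΩ hb (v := fun _ => 1) contDiff_const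
    (hne.imp fun x hx => ⟨hx, one_ne_zero⟩) α⟩

end Bounds

/-! ### Test functions concentrating at a boundary point -/

section TestFunctions

variable {E : Type*} [NormedAddCommGroup E] [InnerProductSpace ℝ E] {Ω : Set E} {ν x₀ : E}
  {ε r : ℝ}

theorem hasFDerivAt_inner_sub_sq (ν x₀ x : E) (κ : ℝ) :
    HasFDerivAt (fun x => inner ℝ ν (x - x₀) - κ * ‖x - x₀‖ ^ 2)
      (innerSL ℝ (ν - (2 * κ) • (x - x₀))) x := by
  have h1 : HasFDerivAt (fun x => x - x₀) (ContinuousLinearMap.id ℝ E) x :=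
    (hasFDerivAt_id x).sub_const x₀
  have h2 := ((innerSL ℝ ν).hasFDerivAt.comp x h1).sub ((h1.norm_sq).const_mul κ)
  refine h2.congr_fderiv ?_
  ext z
  simp
  ring

/-- Functions concentrating at a boundary point at the scale `1 / β`. Up to an exponentially small
error, they satisfy the differential inequalities of `exp (β * inner ν x)`. -/
theorem HasNormalCone.exists_concentrating [FiniteDimensional ℝ E]
    (h : HasNormalCone Ω ν (ε / 8) r x₀)
    (hx₀ : x₀ ∈ frontier Ω) (hr : 0 < r) (hε : 0 < ε) :
    ∃ K > 0, ∃ η > 0, ∃ ρ > 0, ∀ β ≥ (1 : ℝ), ∃ u : E → ℝ, ContDiff ℝ 1 u ∧ (∀ x, 0 ≤ u x) ∧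
      tsupport u ⊆ Metric.closedBall x₀ r ∧
      (∀ x ∈ Metric.ball x₀ ρ, Real.exp (-(β * η / 2)) ≤ u x) ∧
      ∀ x ∈ Ω,
        (‖fderiv ℝ u x‖ ≤ (1 + ε) * β * u x ∧ (1 - ε) * β * u x ≤ fderiv ℝ u x ν) ∨
        (u x ≤ Real.exp (-(β * η)) ∧ ‖fderiv ℝ u x‖ ≤ K * β * Real.exp (-(β * η))) := by
  have hν := h.norm_eq
  let χ : ContDiffBump x₀ := ⟨r / 2, 3 * r / 4, by positivity, by linarith⟩
  have hχc : ContDiff ℝ 1 χ := χ.contDiff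
  obtain ⟨K, hK⟩ := (hχc.continuous_fderiv one_ne_zero).bounded_above_of_compact_support
    (χ.hasCompactSupport.fderiv ℝ)
  have hK0 : 0 ≤ K := (norm_nonneg _).trans (hK x₀)
  -- The exponent has gradient `ν - 2κ(x - x₀)`; this `κ` keeps it within `ε` of `ν` on the ball of
  -- radius `r`.
  set κ := ε / (2 * r) with hκ
  have hκ0 : 0 < κ := by positivity
  have hκr : 2 * κ * r = ε := by rw [hκ]; field_simp
  set η := ε * r / 16 with hη
  have hη0 : 0 < η := by positivity
  set f : E → ℝ := fun x => inner ℝ ν (x - x₀) - κ * ‖x - x₀‖ ^ 2 with hf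
  have hfc : ContDiff ℝ 1 f :=
    (contDiff_const.inner ℝ (contDiff_id.sub contDiff_const)).sub
      (contDiff_const.mul ((contDiff_id.sub contDiff_const).norm_sq ℝ))
  obtain ⟨ρ, hρ, hρf⟩ : ∃ ρ > 0, ∀ x ∈ Metric.ball x₀ ρ, -(η / 2) < f x ∧ x ∈ Metric.ball x₀ (r / 2) := by
    have h1 : ∀ᶠ x in 𝓝 x₀, -(η / 2) < f x := by
      refine continuousAt_const.eventually_lt hfc.continuous.continuousAt ?_
      simp [hf, hη0]
    exact Metric.eventually_nhds_iff_ball.1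
      (h1.and (Metric.ball_mem_nhds x₀ (half_pos hr)))
  have hχ1 : ∀ x ∈ Metric.ball x₀ (r / 2), χ x = 1 := fun x hx =>
    χ.one_of_mem_closedBall (Metric.ball_subset_closedBall hx)
  refine ⟨1 + ε + K, by positivity, η, hη0, ρ, hρ, fun β hβ => ?_⟩
  have hβ0 : 0 < β := by linarith
  set u : E → ℝ := fun x => Real.exp (β * f x) * χ x with hu
  have hts : tsupport u ⊆ Metric.closedBall x₀ (3 * r / 4) := by
    have : tsupport u ⊆ tsupport χ := tsupport_mul_subset_right
    rwa [χ.tsupport_eq] at this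
  have hfd : ∀ x, HasFDerivAt f (innerSL ℝ (ν - (2 * κ) • (x - x₀))) x := fun x =>
    hasFDerivAt_inner_sub_sq ν x₀ x κ
  have hud : ∀ x, fderiv ℝ u x = Real.exp (β * f x) •
      ((χ x * β) • innerSL ℝ (ν - (2 * κ) • (x - x₀)) + fderiv ℝ χ x) := by
    intro x
    have h1 := (((hfd x).const_mul β).exp).mul (hχc.differentiable one_ne_zero x).hasFDerivAt
    refine (h1.congr_fderiv ?_).fderiv
    ext z
    simp
    ring
  have hnorm : ∀ x ∈ Metric.closedBall x₀ r, ‖ν - (2 * κ) • (x - x₀)‖ ≤ 1 + ε := by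
    intro x hx
    rw [mem_closedBall_iff_norm] at hx
    refine (norm_sub_le _ _).trans ?_
    rw [hν, norm_smul, Real.norm_eq_abs, abs_of_pos (by positivity), ← hκr]
    gcongr
  have hinn : ∀ x ∈ Metric.closedBall x₀ r, 1 - ε ≤ inner ℝ (ν - (2 * κ) • (x - x₀)) ν := by
    intro x hx
    rw [mem_closedBall_iff_norm] at hx
    rw [inner_sub_left, real_inner_self_eq_norm_sq, hν, real_inner_smul_left]
    have h1 := real_inner_le_norm (x - x₀) ν
    rw [hν, mul_one] at h1
    have h2 := mul_le_mul_of_nonneg_left (h1.trans hx) (show 0 ≤ 2 * κ by positivity)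
    linarith
  refine ⟨u, ?_, fun x => mul_nonneg (Real.exp_pos _).le χ.nonneg, ?_, ?_, ?_⟩
  · exact (Real.contDiff_exp.comp (contDiff_const.mul hfc)).mul hχc
  · exact hts.trans (Metric.closedBall_subset_closedBall (by linarith))
  · intro x hx
    obtain ⟨h1, h2⟩ := hρf x hx
    rw [hu]
    simp only
    rw [hχ1 x h2, mul_one, Real.exp_le_exp]
    nlinarith
  · intro x hxΩ
    by_cases hx : x ∈ Metric.ball x₀ (r / 2)
    · left
      have hxr : x ∈ Metric.closedBall x₀ r :=
        Metric.ball_subset_closedBall (Metric.ball_subset_ball (by linarith) hx)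
      have hχ' : fderiv ℝ χ x = 0 := by
        have : (χ : E → ℝ) =ᶠ[𝓝 x] fun _ => 1 := by
          filter_upwards [Metric.isOpen_ball.mem_nhds hx] with y hy using hχ1 y hy
        rw [this.fderiv_eq]
        simp
      have hux : u x = Real.exp (β * f x) := by rw [hu]; simp only; rw [hχ1 x hx, mul_one]
      rw [hud x, hχ', hχ1 x hx, hux, one_mul, add_zero]
      constructor
      · rw [norm_smul, norm_smul, innerSL_apply_norm, Real.norm_eq_abs, Real.norm_eq_abs,
          abs_of_pos (Real.exp_pos _), abs_of_pos hβ0]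
        calc _ ≤ Real.exp (β * f x) * (β * (1 + ε)) := by gcongr; exact hnorm x hxr
          _ = _ := by ring
      · simp only [smul_apply, innerSL_apply_apply, smul_eq_mul]
        calc _ = Real.exp (β * f x) * (β * (1 - ε)) := by ring
          _ ≤ _ := by gcongr; exact hinn x hxr
    · right
      by_cases hx2 : x ∈ Metric.closedBall x₀ (3 * r / 4)
      · have hxr : x ∈ Metric.closedBall x₀ r :=
          Metric.closedBall_subset_closedBall (by linarith) hx2
        -- In `Ω` the cone bounds the linear term by `(ε/8)t`, while the penalty is at least
        -- `(ε/4)t` once `t ≥ r/2`. Hence `f ≤ -(ε/8)(r/2) = -η`.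
        have hfx : f x ≤ -η := by
          have h1 : inner ℝ ν (x - x₀) ≤ ε / 8 * ‖x - x₀‖ := by
            by_contra! hlt
            exact h.notMem x₀ hx₀ (Metric.mem_closedBall_self hr.le) x hxr hlt
              (subset_closure hxΩ)
          rw [mem_ball_iff_norm, not_lt] at hx
          simp only [hf]
          set t := ‖x - x₀‖
          have h2 : ε / 4 ≤ κ * t := by
            calc ε / 4 = κ * (r / 2) := by rw [← hκr]; ring
              _ ≤ κ * t := by gcongr
          have h3 : ε / 4 * t ≤ κ * t ^ 2 := by
            calc ε / 4 * t ≤ κ * t * t := by gcongr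
              _ = _ := by ring
          have h4 : ε / 8 * (r / 2) ≤ ε / 8 * t := by gcongr
          rw [hη]
          linarith
        have hexp : Real.exp (β * f x) ≤ Real.exp (-(β * η)) := by
          rw [Real.exp_le_exp]
          nlinarith
        have hχle : χ x ≤ 1 := χ.le_one
        constructor
        · calc u x ≤ Real.exp (β * f x) * 1 := by simp only [hu]; gcongr
            _ ≤ _ := by rw [mul_one]; exact hexp
        · rw [hud x, norm_smul, Real.norm_eq_abs, abs_of_pos (Real.exp_pos _), mul_comm]
          refine mul_le_mul ?_ hexp (Real.exp_pos _).le (by positivity)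
          refine (norm_add_le _ _).trans ?_
          rw [norm_smul, innerSL_apply_norm, Real.norm_eq_abs,
            abs_of_nonneg (mul_nonneg χ.nonneg hβ0.le)]
          calc _ ≤ 1 * β * (1 + ε) + K := by
                gcongr
                · exact hnorm x hxr
                · exact hK x
            _ ≤ (1 + ε + K) * β := by nlinarith
      · have hx3 : x ∉ tsupport u := fun hx3 => hx2 (hts hx3)
        have hd0 : fderiv ℝ u x = 0 := by
          by_contra hne
          exact hx3 (support_fderiv_subset ℝ hne)
        rw [hd0, image_eq_zero_of_notMem_tsupport hx3, norm_zero]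
        exact ⟨(Real.exp_pos _).le, by positivity⟩

end TestFunctions

/-! ### Upper bound for the Rayleigh quotient -/

section UpperBound

variable {d : ℕ} {Ω : Set (EuclideanSpace ℝ (Fin (d + 1)))} {p : ℝ}

theorem fderiv_abs_rpow_of_nonneg {E : Type*} [NormedAddCommGroup E] [NormedSpace ℝ E] {u : E → ℝ}
    (hp : 1 < p) (hu : Differentiable ℝ u) {x : E} (hx : 0 ≤ u x) (z : E) :
    fderiv ℝ (fun x => |u x| ^ p) x z = p * u x ^ (p - 1) * fderiv ℝ u x z := by
  have := hu.fderiv_norm_rpow (x := x) hp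
  simp only [Real.norm_eq_abs] at this
  rw [this, abs_of_nonneg hx]
  have h1 : u x ^ (p - 1) = u x ^ (p - 2) * u x := by
    rw [← Real.rpow_add_one' hx (by linarith)]
    ring_nf
  simp [h1]
  ring

/-- The errors of the concentrating function are of order `exp(-pβη)` up to powers of `β`, whereas
the mass of `u^p` near `x₀` is at least a multiple of `exp(-pβη/2)`. Their ratio still decays
exponentially. -/
theorem HasNormalCones.exists_rayleigh_le (h : HasNormalCones Ω) (hΩ : IsOpen Ω)
    (hb : Bornology.IsBounded Ω) (hfr : (frontier Ω).Nonempty) (hp : 1 < p) {ε : ℝ} (hε : 0 < ε)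
    (hε1 : ε < 1) :
    ∃ C, ∃ η > 0, ∀ β ≥ (1 : ℝ), ∃ q ∈ rayleighValues p Ω (β ^ (p - 1)),
      q ≤ β ^ p * ((1 + ε) ^ p - p * (1 - ε) + C * Real.exp (-(η * β))) := by
  have hp0 : 0 < p := by linarith
  obtain ⟨x₀, hx₀⟩ := hfr
  obtain ⟨ν, r, hr, hc⟩ := h x₀ hx₀ (ε / 8) (by positivity)
  obtain ⟨K, hK, η, hη, ρ, hρ, hβu⟩ := hc.exists_concentrating hx₀ hr hε
  have hW : IsOpen (Ω ∩ Metric.ball x₀ ρ) := hΩ.inter Metric.isOpen_ball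
  have hWb : Bornology.IsBounded (Ω ∩ Metric.ball x₀ ρ) := hb.subset inter_subset_left
  set c := volume.real (Ω ∩ Metric.ball x₀ ρ)
  have hc0 : 0 < c := by
    refine ENNReal.toReal_pos (hW.measure_pos volume ?_).ne' hWb.measure_lt_top.ne
    obtain ⟨z, hz, hzρ⟩ := Metric.mem_closure_iff.1 (frontier_subset_closure hx₀) ρ hρ
    exact ⟨z, hz, by rwa [Metric.mem_ball, dist_comm]⟩
  set V := volume.real Ω
  have hV : 0 ≤ V := measureReal_nonneg
  -- Where `u` is exponentially small, `p * K` bounds the derivative of `u^p` and `p * (1 - ε)` the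
  -- main term, both in units of `β * e`.
  set D := p * K + p * (1 - ε) with hD
  have hD0 : 0 ≤ D := by
    have : 0 ≤ 1 - ε := by linarith
    positivity
  refine ⟨(K ^ p + D) * V / c, p * η / 2, by positivity, fun β hβ => ?_⟩
  have hβ0 : 0 < β := by linarith
  obtain ⟨u, huc, hu0, hus, huρ, huΩ⟩ := hβu β hβ
  have hud := huc.differentiable one_ne_zero
  set w : EuclideanSpace ℝ (Fin (d + 1)) → ℝ := fun x => |u x| ^ p with hw
  have hwc : ContDiff ℝ 1 w := huc.norm_rpow hp
  have hwu : ∀ x, w x = u x ^ p := fun x => by rw [hw]; simp only; rw [abs_of_nonneg (hu0 x)]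
  have hws : tsupport w ⊆ Metric.closedBall x₀ r := by
    refine Subset.trans (closure_mono fun x (hx : w x ≠ 0) (hx0 : u x = 0) => hx ?_) hus
    rw [hwu, hx0, Real.zero_rpow hp0.ne']
  set e := Real.exp (-(p * β * η)) with he
  have hexp : ∀ s : ℝ, Real.exp (-(β * η)) ^ s = Real.exp (-(s * β * η)) := fun s => by
    rw [← Real.exp_mul]; ring_nf
  have hgrad : ∀ x ∈ Ω, ‖gradient u x‖ ^ p ≤ ((1 + ε) * β) ^ p * w x + (K * β) ^ p * e := by
    intro x hx
    rw [norm_gradient, hwu]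
    rcases huΩ x hx with ⟨h1, -⟩ | ⟨-, h1⟩
    · calc _ ≤ ((1 + ε) * β * u x) ^ p := by gcongr
        _ = ((1 + ε) * β) ^ p * u x ^ p := Real.mul_rpow (by positivity) (hu0 x)
        _ ≤ _ := le_add_of_nonneg_right (by positivity)
    · calc _ ≤ (K * β * Real.exp (-(β * η))) ^ p := by gcongr
        _ = (K * β) ^ p * e := by
          rw [Real.mul_rpow (by positivity) (Real.exp_pos _).le, hexp]
        _ ≤ _ := le_add_of_nonneg_left (mul_nonneg (by positivity) (Real.rpow_nonneg (hu0 x) _))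
  have hflux : ∀ x ∈ Ω, p * (1 - ε) * β * w x - D * β * e ≤ fderiv ℝ w x ν := by
    intro x hx
    rw [hw, fderiv_abs_rpow_of_nonneg hp hud (hu0 x), ← hw, hwu]
    have hup : u x ^ p = u x ^ (p - 1) * u x := by
      rw [← Real.rpow_add_one' (hu0 x) (by linarith)]
      ring_nf
    have hup1 : 0 ≤ u x ^ (p - 1) := Real.rpow_nonneg (hu0 x) _
    rcases huΩ x hx with ⟨-, h1⟩ | ⟨h1, h2⟩
    · have h3 := mul_le_mul_of_nonneg_left h1 (mul_nonneg hp0.le hup1)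
      rw [hup]
      have : 0 ≤ D * β * e := by positivity
      linarith
    · have h3 : -(K * β * Real.exp (-(β * η))) ≤ fderiv ℝ u x ν := by
        have h4 := (fderiv ℝ u x).le_opNorm ν
        rw [hc.norm_eq, mul_one, Real.norm_eq_abs] at h4
        exact (abs_le.1 (h4.trans h2)).1
      have h5 : u x ^ (p - 1) ≤ Real.exp (-((p - 1) * β * η)) := by
        rw [← hexp]
        exact Real.rpow_le_rpow (hu0 x) h1 (by linarith)
      have h6 : u x ^ p ≤ e := by
        rw [he, ← hexp]
        exact Real.rpow_le_rpow (hu0 x) h1 hp0.le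
      have h7 : Real.exp (-((p - 1) * β * η)) * Real.exp (-(β * η)) = e := by
        rw [← Real.exp_add, he]
        ring_nf
      have h8 : p * u x ^ (p - 1) * (K * β * Real.exp (-(β * η))) ≤ p * K * β * e := by
        calc _ ≤ p * Real.exp (-((p - 1) * β * η)) * (K * β * Real.exp (-(β * η))) := by gcongr
          _ = p * K * β * e := by rw [← h7]; ring
      have h9 := mul_le_mul_of_nonneg_left h3 (mul_nonneg hp0.le hup1)
      have h10 : p * (1 - ε) * β * u x ^ p ≤ p * (1 - ε) * β * e := by
        have : 0 ≤ 1 - ε := by linarith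
        gcongr
      rw [hD]
      linarith
  have hIw : IntegrableOn w Ω := hwc.continuous.integrableOn_of_isBounded hb
  have hIc : ∀ a : ℝ, IntegrableOn (fun _ => a) Ω := fun a =>
    Continuous.integrableOn_of_isBounded continuous_const hb
  have hintc : ∀ a : ℝ, ∫ _ in Ω, a = a * V := fun a => by
    rw [setIntegral_const, smul_eq_mul, mul_comm]
  set M := ∫ x in Ω, w x with hM
  have hN : ∫ x in Ω, ‖gradient u x‖ ^ p ≤ ((1 + ε) * β) ^ p * M + (K * β) ^ p * e * V := by
    rw [← hintc, hM, ← integral_const_mul, ← integral_add (hIw.const_mul _) (hIc _)]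
    refine setIntegral_mono_on ?_ ((hIw.const_mul _).add (hIc _)) hΩ.measurableSet hgrad
    exact Continuous.integrableOn_of_isBounded
      ((continuous_gradient huc).norm.rpow_const fun _ => Or.inr hp0.le) hb
  have hT : p * (1 - ε) * β * M - D * β * e * V ≤ ∫ x, w x ∂(surfaceMeasure Ω) := by
    -- The lower flux bound does not involve `k`, so the crude value `1` loses nothing.
    refine le_trans ?_ (hc.setIntegral_frontier (k := 1) hΩ (d := d) (by simp) (by positivity)
      (by linarith) (by norm_num; nlinarith) hwc (fun x => by positivity) hws).1
    rw [← hintc, hM, ← integral_const_mul, ← integral_sub (hIw.const_mul _) (hIc _)]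
    refine setIntegral_mono_on ((hIw.const_mul _).sub (hIc _)) ?_ hΩ.measurableSet hflux
    exact Continuous.integrableOn_of_isBounded
      ((hwc.continuous_fderiv one_ne_zero).clm_apply continuous_const) hb
  have hMc : c * Real.exp (-(p * η / 2 * β)) ≤ M := by
    calc c * Real.exp (-(p * η / 2 * β))
        = ∫ _ in Ω ∩ Metric.ball x₀ ρ, Real.exp (-(p * η / 2 * β)) := by
          rw [setIntegral_const, smul_eq_mul]
      _ ≤ ∫ x in Ω ∩ Metric.ball x₀ ρ, w x := by
          refine setIntegral_mono_on (Continuous.integrableOn_of_isBounded continuous_const hWb)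
            (hwc.continuous.integrableOn_of_isBounded hWb) hW.measurableSet fun x hx => ?_
          rw [hwu]
          have := Real.rpow_le_rpow (Real.exp_pos _).le (huρ x hx.2) hp0.le
          rw [← Real.exp_mul] at this
          refine this.trans_eq' (congrArg Real.exp ?_)
          ring
      _ ≤ M := setIntegral_mono_set hIw (Eventually.of_forall fun x => by positivity)
          (Eventually.of_forall inter_subset_left)
  have hM0 : 0 < M := lt_of_lt_of_le (by positivity) hMc
  refine ⟨_, h.mem_rayleighValues_of_contDiff hΩ hb huc ?_ _, ?_⟩
  · obtain ⟨z, hz, hzρ⟩ := Metric.mem_closure_iff.1 (frontier_subset_closure hx₀) ρ hρ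
    exact ⟨z, hz, ((Real.exp_pos _).trans_le
      (huρ z (by rwa [Metric.mem_ball, dist_comm]))).ne'⟩
  · rw [div_le_iff₀ hM0]
    have hbp : β ^ (p - 1) * β = β ^ p := by
      rw [← Real.rpow_add_one' hβ0.le (by linarith)]
      ring_nf
    have h1 := mul_le_mul_of_nonneg_left hT (Real.rpow_nonneg hβ0.le (p - 1))
    have h2 : β ^ (p - 1) * (p * (1 - ε) * β * M - D * β * e * V) =
        β ^ p * (p * (1 - ε) * M - D * e * V) := by rw [← hbp]; ring
    rw [Real.mul_rpow (by positivity) hβ0.le, Real.mul_rpow hK.le hβ0.le] at hN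
    have h3 : e * c ≤ Real.exp (-(p * η / 2 * β)) * M := by
      calc e * c = Real.exp (-(p * η / 2 * β)) * (c * Real.exp (-(p * η / 2 * β))) := by
            rw [mul_left_comm, ← Real.exp_add, he, mul_comm]
            ring_nf
        _ ≤ _ := by gcongr
    have h4 : e * ((K ^ p + D) * V) ≤
        (K ^ p + D) * V / c * Real.exp (-(p * η / 2 * β)) * M := by
      have := mul_le_mul_of_nonneg_left h3 (show 0 ≤ (K ^ p + D) * V / c by positivity)
      calc e * ((K ^ p + D) * V) = (K ^ p + D) * V / c * (e * c) := by field_simp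
        _ ≤ _ := this
        _ = _ := by ring
    have h5 := mul_le_mul_of_nonneg_left h4 (Real.rpow_nonneg hβ0.le p)
    linarith

end UpperBound

/-! ### Passage to the limit -/

section Asymptotics

variable {d : ℕ} {Ω : Set (EuclideanSpace ℝ (Fin (d + 1)))} {p : ℝ}

theorem frontier_nonempty_of_isBounded (hb : Bornology.IsBounded Ω) (hne : Ω.Nonempty) :
    (frontier Ω).Nonempty := by
  rw [nonempty_frontier_iff]
  exact ⟨hne, fun h => NormedSpace.unbounded_univ ℝ (EuclideanSpace ℝ (Fin (d + 1))) (h ▸ hb)⟩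

theorem HasNormalCones.bddBelow_rayleighValues (h : HasNormalCones Ω) (hΩ : IsOpen Ω)
    (hb : Bornology.IsBounded Ω) (hp : 1 < p) {α : ℝ} (hα : 0 < α) :
    BddBelow (rayleighValues p Ω α) := by
  obtain ⟨C, -, hC⟩ := h.exists_le_of_mem_rayleighValues hΩ hb hp one_lt_two
  exact ⟨_, fun q hq => hC α hα q hq⟩

theorem HasNormalCones.eventually_le_Lam (h : HasNormalCones Ω) (hΩ : IsOpen Ω)
    (hb : Bornology.IsBounded Ω) (hne : Ω.Nonempty) (hp : 1 < p) {c : ℝ} (hc : 0 < c) :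
    ∀ᶠ α : ℝ in atTop, (1 - p - c) * α ^ (p / (p - 1)) ≤ Lam p Ω α := by
  -- Half of `c` pays for `L > 1`, the other half absorbs the term `C * α` for large `α`.
  obtain ⟨L, hL, hLc⟩ : ∃ L > 1, (p - 1) * L ^ (p / (p - 1)) < p - 1 + c / 2 := by
    have hev : ∀ᶠ L : ℝ in 𝓝[>] 1, (p - 1) * L ^ (p / (p - 1)) < p - 1 + c / 2 := by
      refine nhdsWithin_le_nhds (ContinuousAt.eventually_lt ?_ continuousAt_const ?_)
      · exact continuousAt_const.mul
          (Real.continuousAt_rpow_const 1 _ (Or.inl one_ne_zero))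
      · simp only [Real.one_rpow]
        linarith
    obtain ⟨L, hL, hL1⟩ := (hev.and self_mem_nhdsWithin).exists
    exact ⟨L, hL1, hL⟩
  obtain ⟨C, hC, hCq⟩ := h.exists_le_of_mem_rayleighValues hΩ hb hp hL
  have hp1 : 0 < p - 1 := by linarith
  have hexp : 0 < p / (p - 1) - 1 := by
    rw [sub_pos, lt_div_iff₀ hp1]
    linarith
  filter_upwards [(tendsto_rpow_atTop hexp).eventually_ge_atTop (C / (c / 2)),
    eventually_gt_atTop 0] with α hα hα0
  refine le_csInf (h.rayleighValues_nonempty hΩ hb hne α) fun q hq => le_trans ?_ (hCq α hα0 q hq)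
  rw [div_le_iff₀ (by positivity)] at hα
  have h1 : α ^ (p / (p - 1) - 1) * α = α ^ (p / (p - 1)) := by
    rw [← Real.rpow_add_one hα0.ne', sub_add_cancel]
  have h2 := mul_le_mul_of_nonneg_right hα hα0.le
  have h3 := mul_le_mul_of_nonneg_right hLc.le (Real.rpow_nonneg hα0.le (p / (p - 1)))
  rw [Real.mul_rpow (by linarith) hα0.le]
  rw [mul_right_comm, h1] at h2
  linarith

theorem HasNormalCones.eventually_Lam_le (h : HasNormalCones Ω) (hΩ : IsOpen Ω)
    (hb : Bornology.IsBounded Ω) (hne : Ω.Nonempty) (hp : 1 < p) {c : ℝ} (hc : 0 < c) :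
    ∀ᶠ α : ℝ in atTop, Lam p Ω α ≤ (1 - p + c) * α ^ (p / (p - 1)) := by
  -- The left side tends to `1 - p` as `ε → 0`; the other half of `c` is left for the exponential
  -- error.
  obtain ⟨ε, hε, hε1, hεc⟩ : ∃ ε > 0, ε < 1 ∧ (1 + ε) ^ p - p * (1 - ε) < 1 - p + c / 2 := by
    have hev : ∀ᶠ ε : ℝ in 𝓝[>] 0, ε < 1 ∧ (1 + ε) ^ p - p * (1 - ε) < 1 - p + c / 2 := by
      refine nhdsWithin_le_nhds ((eventually_lt_nhds one_pos).and
        (ContinuousAt.eventually_lt ?_ continuousAt_const ?_))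
      · refine ContinuousAt.sub (ContinuousAt.rpow_const (by fun_prop) (Or.inl (by simp)))
          (by fun_prop)
      · simp only [add_zero, Real.one_rpow, sub_zero, mul_one]
        linarith
    obtain ⟨ε, ⟨h1, h2⟩, h3⟩ := (hev.and self_mem_nhdsWithin).exists
    exact ⟨ε, h3, h1, h2⟩
  obtain ⟨C, η, hη, hCβ⟩ := h.exists_rayleigh_le hΩ hb (frontier_nonempty_of_isBounded hb hne) hp
    hε hε1
  have hp1 : 0 < p - 1 := by linarith
  have hβ : Tendsto (fun α : ℝ => α ^ (p - 1)⁻¹) atTop atTop := tendsto_rpow_atTop (by positivity)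
  have herr : Tendsto (fun β : ℝ => C * Real.exp (-(η * β))) atTop (𝓝 0) := by
    have := (Real.tendsto_exp_neg_atTop_nhds_zero.comp
      (tendsto_id.const_mul_atTop hη)).const_mul C
    simpa using this
  filter_upwards [hβ.eventually_ge_atTop 1, (herr.comp hβ).eventually_lt_const (half_pos hc),
    eventually_gt_atTop 0] with α h1 h2 hα0
  obtain ⟨q, hq, hqle⟩ := hCβ _ h1
  rw [← Real.rpow_mul hα0.le, inv_mul_cancel₀ hp1.ne', Real.rpow_one] at hq
  refine (csInf_le (h.bddBelow_rayleighValues hΩ hb hp hα0) hq).trans (hqle.trans ?_)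
  rw [← Real.rpow_mul hα0.le, inv_mul_eq_div, mul_comm]
  refine mul_le_mul_of_nonneg_right ?_ (Real.rpow_nonneg hα0.le _)
  simp only [Function.comp_apply] at h2
  linarith

end Asymptotics

end RobinPLaplacian

theorem theorem1 {d : ℕ} (Ω : Set (EuclideanSpace ℝ (Fin (d + 1))))
    (hΩ_open : IsOpen Ω) (hΩ_bdd : Bornology.IsBounded Ω) (hΩ_ne : Ω.Nonempty)
    (hΩ_C1 : RobinPLaplacian.HasC1Boundary Ω) (p : ℝ) (hp : 1 < p) :
    (∀ α : ℝ, 0 < α → (RobinPLaplacian.rayleighValues p Ω α).Nonempty ∧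
      BddBelow (RobinPLaplacian.rayleighValues p Ω α)) ∧
    (fun α : ℝ => RobinPLaplacian.Lam p Ω α - (1 - p) * α ^ (p / (p - 1)))
      =o[atTop] (fun α : ℝ => α ^ (p / (p - 1))) := by
  have h : RobinPLaplacian.HasNormalCones Ω := fun x hx δ hδ => hΩ_C1.exists_hasNormalCone hx hδ
  refine ⟨fun α hα => ⟨h.rayleighValues_nonempty hΩ_open hΩ_bdd hΩ_ne α,
    h.bddBelow_rayleighValues hΩ_open hΩ_bdd hp hα⟩, isLittleO_iff.2 fun c hc => ?_⟩
  filter_upwards [h.eventually_le_Lam hΩ_open hΩ_bdd hΩ_ne hp hc,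
    h.eventually_Lam_le hΩ_open hΩ_bdd hΩ_ne hp hc, eventually_ge_atTop 0] with α h1 h2 hα
  rw [Real.norm_eq_abs, Real.norm_of_nonneg (Real.rpow_nonneg hα _), abs_le]
  constructor <;> linarith
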